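/- Let $\mathbb K$ be a field of characteristic $0$. Let $\mathrm{Sym}=\mathbb K\langle S_1,S_2,\dots\rangle$ be the algebra of noncommutative symmetric functions ($\deg S_n=n$, $S_0=1$), with coproduct the algebra morphism given by $\Delta S_n=\sum_{i+j=n}S_i\otimes S_j$. Let $\mathrm{QSym}$ be the span of the quasi-monomial functions $M_I=\sum_{n_1<\dots<n_r}x_{n_1}^{i_1}\cdots x_{n_r}^{i_r}$ ($I=(i_1,\dots,i_r)$ a composition, i.e. a finite sequence of positive integers, with $|I|=i_1+\dots+i_r$), with the product of power series, paired with $\mathrm{Sym}$ by $\langle M_I,S^J\rangle=\delta_{IJ}$, where $P^I:=P_{i_1}\cdots P_{i_r}$ for any sequence $(P_n)_{n\ge1}$ in $\mathrm{Sym}$. Write $\langle w\mid u\mathbin{\sqcup\!\sqcup} v\rangle$ for the multiplicity of the word $w$ in the shuffle of the words $u$ and $v$, and $W_I=a^{i_1-1}b\,a^{i_2-1}b\cdots a^{i_r-1}b$ for the binary word of $I$. For a set partition $\pi$ of $\{1,\dots,n\}$, let $K(\pi)$ be the composition of $n$ formed by the sizes of the blocks of $\pi$, ordered by increasing maximal elements,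 and $C(\pi)$ the composition of $n$ whose partial sums are the maximal elements of the blocks. For compositions $I,J$ of $n$ put $$c_{IJ}=\#\{\pi \mid K(\pi)=I,\ C(\pi)=J\}$$ (this is $0$ unless $I$ and $J$ have the same length). **1.** Let $(V_I)$ be any basis of $\mathrm{Sym}$, indexed by compositions, whose coproduct is the unshuffle of compositions: $$\Delta V_I=\sum_{K,L}\langle I\mid K\mathbin{\sqcup\!\sqcup} L\rangle\,V_K\otimes V_L .$$ Put $X_J=\sum_{I}c_{IJ}V_I$, the sum being over the compositions $I$ of $|J|$. Then $(X_J)$ is a basis of $\mathrm{Sym}$, and every family $(Z_I)$ in $\mathrm{QSym}$ dual to it, i.e. with $\langle Z_I,X_J\rangle=\delta_{IJ}$, satisfies the binary shuffle rule $$Z_IZ_J=\sum_K\langle W_K\mid W_I\mathbin{\sqcup\!\sqcup} W_J\rangle\,Z_K .$$ If each $V_I$ is homogeneous of degree $|I|$, then there is exactly one basis $(Z_I)$ of $\mathrm{QSym}$ dual to $(X_J)$. **2.** If all $P_n$ ($n\ge1$) are primitive, i.e. $\Delta P_n=P_n\otimes1+1\otimes P_n$, then the coproduct of the family $(P^I)$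 is the unshuffle of compositions, so that part 1 applies to $(P^I)$ whenever it is a basis of $\mathrm{Sym}$. **3.** Let the power sums $\Psi_n$ and $\Phi_n$ be defined by $$nS_n=\sum_{i=1}^{n}S_{n-i}\Psi_i,\qquad \sum_{n\ge1}\frac{\Phi_n}{n}t^n=\log\Bigl(\sum_{n\ge0}S_nt^n\Bigr).$$ All $\Psi_n$ and all $\Phi_n$ ($n\ge1$) are primitive, and each of the families $(\Psi^I)$ and $(\Phi^I)$ is a basis of $\mathrm{Sym}$ whose coproduct is the unshuffle of compositions, with the member of index $I$ homogeneous of degree $|I|$; so the whole of part 1 applies to them. -/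

import Mathlib

open scoped TensorProduct

namespace NCSF

/-! ### Words and compositions -/

/-- All compositions (of all integers `n ≥ 0`). -/
abbrev Comp : Type := Σ n : ℕ, Composition n

/-- The shuffle of two words, as a multiset of words; the coefficient `⟨w | u ⧢ v⟩` is the
multiplicity of `w` in it. -/
def shuffle {α : Type*} : List α → List α → Multiset (List α)
  | [], v => {v}
  | a :: u, [] => {a :: u}
  | a :: u, b :: v =>
      (shuffle u (b :: v)).map (fun w => a :: w) + (shuffle (a :: u) v).map (fun w => b :: w)
termination_by u v => u.length + v.length

/-- The binary word `W_I = a^{i₁-1} b a^{i₂-1} b ⋯ a^{iᵣ-1} b` of a composition `I`,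
with `false` for the letter `a` and `true` for the letter `b`. -/
def binaryWord {n : ℕ} (I : Composition n) : List Bool :=
  I.blocks.flatMap fun i => List.replicate (i - 1) false ++ [true]

/-! ### Two compositions read off from a set partition -/

/-- The increasing list of the maximal elements of the blocks of a set partition
(of `{0, …, n-1}`). -/
def blockMaxima {n : ℕ} (π : Finpartition (Finset.univ : Finset (Fin n))) : List (Fin n) :=
  (Finset.univ.filter fun m : Fin n => ∀ j ∈ π.part m, j ≤ m).sort (· ≤ ·)

/-- `K(π)`: the sizes of the blocks, ordered by increasing maximal elements. -/
def compK {n : ℕ} (π : Finpartition (Finset.univ : Finset (Fin n))) : List ℕ :=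
  (blockMaxima π).map fun m => (π.part m).card

/-- Successive differences of a list, the first one being taken with `p`. -/
def diffs : ℕ → List ℕ → List ℕ
  | _, [] => []
  | p, m :: l => (m - p) :: diffs m l

/-- `C(π)`: the composition of `n` whose partial sums are the maximal elements of the blocks,
regarded as elements of `{1, …, n}`. -/
def compC {n : ℕ} (π : Finpartition (Finset.univ : Finset (Fin n))) : List ℕ :=
  diffs 0 ((blockMaxima π).map fun m => (m : ℕ) + 1)

/-- `c_{IJ} = #{π ∈ Π_n | K(π) = I and C(π) = J}`. -/
def c {n : ℕ} (I J : Composition n) : ℕ :=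
  (Finset.univ.filter fun π : Finpartition (Finset.univ : Finset (Fin n)) =>
    compK π = I.blocks ∧ compC π = J.blocks).card

/-! ### Noncommutative symmetric functions -/

section Sym

variable (k : Type*) [Field k]

/-- The algebra of noncommutative symmetric functions: the free associative algebra on
`S_1, S_2, …`. -/
abbrev NSym : Type _ := FreeAlgebra k ℕ+

/-- The complete functions `S_n`, with `S_0 = 1`. -/
def S : ℕ → NSym k
  | 0 => 1
  | n + 1 => FreeAlgebra.ι k n.succPNat

/-- The coproduct of `Sym`: the algebra morphism with `Δ S_n = ∑_{i+j=n} S_i ⊗ S_j`. -/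
noncomputable def comul : NSym k →ₐ[k] NSym k ⊗[k] NSym k :=
  FreeAlgebra.lift k fun m : ℕ+ =>
    ∑ p ∈ Finset.HasAntidiagonal.antidiagonal (m : ℕ), S k p.1 ⊗ₜ[k] S k p.2

variable {k}

/-- The product `P^I = P_{i₁} ⋯ P_{iᵣ}` of members of a sequence `(P_n)_{n ≥ 1}` (`P 0` is not
used). -/
def prodFamily (P : ℕ → NSym k) (I : Comp) : NSym k := (I.2.blocks.map P).prod

/-- Primitive elements. -/
def IsPrimitive (x : NSym k) : Prop := comul k x = x ⊗ₜ[k] 1 + 1 ⊗ₜ[k] x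

variable (k) in
/-- The homogeneous component of degree `n` of `Sym`, where `S_m` has degree `m`. -/
noncomputable def homogeneous (n : ℕ) : Submodule k (NSym k) :=
  Submodule.span k (Set.range fun I : Composition n => prodFamily (S k) ⟨n, I⟩)

/-- The coproduct of the family `V` is the unshuffle of compositions:
`Δ V_I = ∑_{K,L} ⟨I | K ⧢ L⟩ V_K ⊗ V_L`. Only compositions with `|K| + |L| = |I|` contribute. -/
def HasUnshuffleCoproduct (V : Comp → NSym k) : Prop :=
  ∀ (n : ℕ) (I : Composition n),
    comul k (V ⟨n, I⟩) =
      ∑ p ∈ Finset.HasAntidiagonal.antidiagonal n, ∑ K : Composition p.1, ∑ L : Composition p.2,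
        ((shuffle K.blocks L.blocks).count I.blocks) • (V ⟨p.1, K⟩ ⊗ₜ[k] V ⟨p.2, L⟩)

/-- `X_J = ∑_I c_{IJ} V_I`. -/
def binaryX (V : Comp → NSym k) (J : Comp) : NSym k :=
  ∑ I : Composition J.1, c I J.2 • V ⟨J.1, I⟩

variable (k) in
/-- The power sums of the first kind: `n S_n = ∑_{i=1}^{n} S_{n-i} Ψ_i` (and `Ψ_0 = 0`, so that
the term `i = 0` below vanishes). -/
noncomputable def Psi (n : ℕ) : NSym k :=
  (n : k) • S k n - ∑ i : Fin n, S k (n - i) * Psi i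
termination_by n
decreasing_by exact i.2

variable (k) in
/-- The power sums of the second kind: `∑_{n ≥ 1} Φ_n tⁿ / n = log (∑_{n ≥ 0} S_n tⁿ)`, with
`log (1 + u) = ∑_{m ≥ 1} (-1)^{m-1} u^m / m`; since `u` has no constant term, only `m ≤ n`
contribute to the coefficient of `tⁿ`. -/
noncomputable def Phi (n : ℕ) : NSym k :=
  (n : k) • ∑ m ∈ Finset.Icc 1 n,
    ((-1 : k) ^ (m - 1) / (m : k)) • PowerSeries.coeff n ((PowerSeries.mk (S k) - 1) ^ m)

end Sym

/-! ### Quasi-symmetric functions -/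

section QSym

variable (k : Type*) [Field k]

/-- The quasi-monomial function `M_I = ∑_{n₁ < ⋯ < nᵣ} x_{n₁}^{i₁} ⋯ x_{nᵣ}^{iᵣ}` in the variables
`x_0, x_1, …`: the sum of the monomials whose nonzero exponents, read in the order of the
variables, form `I`. -/
def quasiMonomial (I : Comp) : MvPowerSeries ℕ k := fun e =>
  if (e.support.sort (· ≤ ·)).map e = I.2.blocks then 1 else 0

/-- `QSym`, the linear span of the quasi-monomial functions. -/
def QSym : Submodule k (MvPowerSeries ℕ k) := Submodule.span k (Set.range (quasiMonomial k))

variable {k}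

/-- The duality `⟨f, ·⟩ : Sym → k`, determined by `⟨M_I, S^J⟩ = δ_{IJ}`: the value of `⟨f, S^I⟩`
is the coefficient of `M_I` in `f`, which is the coefficient of `x_0^{i₁} ⋯ x_{r-1}^{iᵣ}`. -/
noncomputable def pairing (f : QSym k) : NSym k →ₗ[k] k :=
  (FreeAlgebra.basisFreeMonoid k ℕ+).constr k fun w =>
    MvPowerSeries.coeff (w.toList.map fun i : ℕ+ => (i : ℕ)).toFinsupp (f : MvPowerSeries ℕ k)

/-- The family `Z` of `QSym` is dual to the family `X` of `Sym`. -/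
def IsDual (Z : Comp → QSym k) (X : Comp → NSym k) : Prop :=
  ∀ I J : Comp, pairing (Z I) (X J) = if I = J then 1 else 0

/-- The binary shuffle rule `Z_I Z_J = ∑_K ⟨W_K | W_I ⧢ W_J⟩ Z_K`. Only compositions with
`|K| = |I| + |J|` contribute. -/
def BinaryShuffleRule (Z : Comp → QSym k) : Prop :=
  ∀ (m n : ℕ) (I : Composition m) (J : Composition n),
    (Z ⟨m, I⟩ : MvPowerSeries ℕ k) * (Z ⟨n, J⟩ : MvPowerSeries ℕ k) =
      ∑ K : Composition (m + n),
        ((shuffle (binaryWord I) (binaryWord J)).count (binaryWord K)) •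
          (Z ⟨m + n, K⟩ : MvPowerSeries ℕ k)

end QSym

end NCSF

/-! Scan 1, …, n along the binary word of `J`. A letter a is an element that waits for its block. A
letter b is the maximum of the next block, of size i, which takes i - 1 of the waiting elements. In
an exponential generating function that records how many elements wait, a acts as d/dx and b as
multiplication by x^(i-1)/(i-1)!. The value at 0 is `c I J`, by `c_eq_numPartitions` and
`eval_iterate_derivative_egf`.

By the Leibniz rule, the letter a in front of a product of two such functions goes to either factor,
while b follows the list that supplies the size. So summing over the shuffles of two lists of sizes
is the same as summing over the splittings of the word (`sum_shuffle_egf`). The unshuffle of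
compositions for `V` thus becomes the unshuffle of binary words for `X`, extended to all words with
value 0 on those ending in a (`comul_binaryX`, `wordX_append_false`). Since the product of QSym is
dual to the coproduct of Sym (`coeff_toFinsupp_mul_eq_comul`), a dual family obeys the binary
shuffle rule. The coefficients `c` are unitriangular for the lexicographic order, so `X` is a basis.
For homogeneous `V` its coordinate functionals are finite combinations of quasi-monomials, which
gives the unique dual basis.

For power sums, the series σ of the complete functions satisfies Δσ = (σ ⊗ 1)(1 ⊗ σ) with commuting
factors. The logarithm and the logarithmic derivative are then additive, so `Phi` and `Psi` are
primitive. Both equal n S_n up to lower generators, so S_n ↦ P_n is a triangular automorphism and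
maps the basis S^I to P^I. -/

namespace NCSF

/-! ### Unshuffles -/

section Words

variable {α : Type*}

@[simp] lemma shuffle_nil_left (v : List α) : shuffle [] v = {v} := by
  simp [shuffle]

@[simp] lemma shuffle_nil_right (u : List α) : shuffle u [] = {u} := by
  cases u <;> simp [shuffle]

lemma shuffle_cons_cons (a b : α) (u v : List α) :
    shuffle (a :: u) (b :: v) =
      (shuffle u (b :: v)).map (a :: ·) + (shuffle (a :: u) v).map (b :: ·) := by
  rw [shuffle]

/-- All ways to split a word into a subword and its complement. -/
def splits : List α → Multiset (List α × List α)
  | [] => {([], [])}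
  | a :: w => (splits w).map (fun p => (a :: p.1, p.2)) + (splits w).map (fun p => (p.1, a :: p.2))

lemma length_add_length_of_mem_splits {w : List α} {p : List α × List α} (hp : p ∈ splits w) :
    p.1.length + p.2.length = w.length := by
  induction w generalizing p with
  | nil => simp_all [splits]
  | cons a w ih =>
    simp only [splits, Multiset.mem_add, Multiset.mem_map] at hp
    rcases hp with ⟨q, hq, rfl⟩ | ⟨q, hq, rfl⟩ <;> simp [← ih hq] <;> omega

lemma perm_of_mem_splits {w : List α} {p : List α × List α} (hp : p ∈ splits w) :
    (p.1 ++ p.2).Perm w := by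
  induction w generalizing p with
  | nil => simp_all [splits]
  | cons a w ih =>
    simp only [splits, Multiset.mem_add, Multiset.mem_map] at hp
    rcases hp with ⟨q, hq, rfl⟩ | ⟨q, hq, rfl⟩
    · simpa using ih hq
    · exact List.perm_middle.trans ((ih hq).cons a)

lemma perm_of_mem_shuffle {u v w : List α} (hw : w ∈ shuffle u v) : w.Perm (u ++ v) := by
  induction u generalizing v w with
  | nil => simp_all
  | cons a u ihu =>
    induction v generalizing w with
    | nil => simp_all
    | cons b v ihv =>
      rw [shuffle_cons_cons, Multiset.mem_add, Multiset.mem_map, Multiset.mem_map] at hw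
      rcases hw with ⟨x, hx, rfl⟩ | ⟨x, hx, rfl⟩
      · exact (ihu hx).cons a
      · exact ((ihv hx).cons b).trans (List.perm_middle (l₁ := a :: u)).symm

lemma count_map_cons_self [DecidableEq α] (a : α) (w : List α) (s : Multiset (List α)) :
    (s.map (a :: ·)).count (a :: w) = s.count w :=
  Multiset.count_map_eq_count' _ _ (List.cons_injective) _

lemma count_map_cons_of_ne [DecidableEq α] {a b : α} (h : a ≠ b) (w : List α)
    (s : Multiset (List α)) : (s.map (b :: ·)).count (a :: w) = 0 := by
  rw [Multiset.count_eq_zero, Multiset.mem_map]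
  rintro ⟨x, -, hx⟩
  exact h (List.cons.inj hx).1.symm

lemma count_map_cons [DecidableEq α] (a b : α) (w : List α)
    (s : Multiset (List α)) :
    (s.map (b :: ·)).count (a :: w) = if a = b then s.count w else 0 := by
  split_ifs with h
  · subst h; exact count_map_cons_self _ _ _
  · exact count_map_cons_of_ne h _ _

lemma count_map_cons_fst [DecidableEq α] (a : α) (u v : List α)
    (s : Multiset (List α × List α)) :
    (s.map fun p => (a :: p.1, p.2)).count (u, v) =
      match u with
      | [] => 0
      | b :: u' => if b = a then s.count (u', v) else 0 := by
  have hinj : Function.Injective fun p : List α × List α => (a :: p.1, p.2) := by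
    rintro ⟨_, _⟩ ⟨_, _⟩ h; simpa using h
  cases u with
  | nil => simp
  | cons b u =>
    dsimp only
    split_ifs with h
    · subst h
      exact Multiset.count_map_eq_count' _ s hinj (u, v)
    · simp only [Multiset.count_eq_zero, Multiset.mem_map, Prod.mk.injEq, List.cons.injEq]
      rintro ⟨p, -, ⟨h', -⟩, -⟩
      exact h h'.symm

lemma count_map_cons_snd [DecidableEq α] (a : α) (u v : List α)
    (s : Multiset (List α × List α)) :
    (s.map fun p => (p.1, a :: p.2)).count (u, v) =
      match v with
      | [] => 0
      | b :: v' => if b = a then s.count (u, v') else 0 := by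
  have hinj : Function.Injective fun p : List α × List α => (p.1, a :: p.2) := by
    rintro ⟨_, _⟩ ⟨_, _⟩ h; simpa using h
  cases v with
  | nil => simp
  | cons b v =>
    dsimp only
    split_ifs with h
    · subst h
      exact Multiset.count_map_eq_count' _ s hinj (u, v)
    · simp only [Multiset.count_eq_zero, Multiset.mem_map, Prod.mk.injEq, List.cons.injEq]
      rintro ⟨p, -, -, ⟨h', -⟩⟩
      exact h h'.symm

/-- Splitting is adjoint to shuffling. -/
lemma count_splits [DecidableEq α] (w u v : List α) :
    (splits w).count (u, v) = (shuffle u v).count w := by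
  induction w generalizing u v with
  | nil =>
    cases u <;> cases v <;> simp [splits, shuffle_cons_cons]
  | cons a w ih =>
    rw [splits, Multiset.count_add, count_map_cons_fst, count_map_cons_snd]
    cases u with
    | nil =>
      cases v with
      | nil => simp
      | cons b v =>
        simp only [ih, shuffle_nil_left, Multiset.count_singleton, List.cons.injEq, zero_add]
        by_cases h : b = a <;> simp [h, eq_comm (a := a), eq_comm (a := w)]
    | cons c u =>
      cases v with
      | nil =>
        simp only [ih, shuffle_nil_right, Multiset.count_singleton, List.cons.injEq, add_zero]
        by_cases h : c = a <;> simp [h, eq_comm (a := a), eq_comm (a := w)]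
      | cons b v =>
        simp only [ih, shuffle_cons_cons, Multiset.count_add, count_map_cons, eq_comm]

end Words

/-! ### Exponential generating functions of the coefficients `c` -/

section Egf

variable (k : Type*) [Field k]

open Polynomial

/-- The exponential generating function, in the number of elements waiting to be put into a block,
of the ways to finish a set partition whose remaining blocks have the sizes `A`, their maxima
being marked by the letters `true` of the word. -/
noncomputable def egf : List Bool → List ℕ → k[X]
  | [], [] => 1
  | [], _ :: _ => 0
  | false :: w, A => derivative (egf w A)
  | true :: _, [] => 0
  | true :: w, i :: A => C (((i - 1).factorial : k)⁻¹) * X ^ (i - 1) * egf w A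

/-- Shuffling the sizes of the blocks amounts to splitting the word of the maxima. -/
lemma sum_shuffle_egf (w : List Bool) (A B : List ℕ) :
    ((shuffle A B).map (egf k w)).sum =
      ((splits w).map fun p => egf k p.1 A * egf k p.2 B).sum := by
  induction w generalizing A B with
  | nil =>
    cases A <;> cases B <;>
      simp [splits, egf, shuffle_cons_cons, Multiset.map_map, Function.comp_def]
  | cons x w ih =>
    cases x with
    | false =>
      have h : ((shuffle A B).map (egf k (false :: w))).sum =
          derivative ((shuffle A B).map (egf k w)).sum := by
        rw [map_multiset_sum, Multiset.map_map]; rfl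
      -- Leibniz rule: the derivative falls on one of the two factors, just as the letter goes to
      -- one of the two subwords.
      rw [h, ih, map_multiset_sum, Multiset.map_map, splits, Multiset.map_add, Multiset.sum_add,
        Multiset.map_map, Multiset.map_map, ← Multiset.sum_map_add]
      simp [egf, derivative_mul]
    | true =>
      have hcons (i : ℕ) (s : Multiset (List ℕ)) :
          (s.map fun x => egf k (true :: w) (i :: x)).sum =
            C (((i - 1).factorial : k)⁻¹) * X ^ (i - 1) * (s.map (egf k w)).sum := by
        rw [← Multiset.sum_map_mul_left]; rfl
      rw [splits, Multiset.map_add, Multiset.sum_add, Multiset.map_map, Multiset.map_map]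
      cases A with
      | nil =>
        cases B with
        | nil => simp [egf, Function.comp_def]
        | cons j B =>
          have := ih [] B
          simp only [shuffle_nil_left, Multiset.map_singleton, Multiset.sum_singleton] at this ⊢
          simp only [egf, this, Function.comp_def, zero_mul, Multiset.map_const',
            Multiset.sum_replicate, smul_zero, zero_add, ← Multiset.sum_map_mul_left]
          congr 2; ext1 p; ring
      | cons i A =>
        cases B with
        | nil =>
          have := ih A []
          simp only [shuffle_nil_right, Multiset.map_singleton, Multiset.sum_singleton] at this ⊢
          simp only [egf, this, Function.comp_def, mul_zero, Multiset.map_const',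
            Multiset.sum_replicate, smul_zero, add_zero, ← Multiset.sum_map_mul_left]
          congr 2; ext1 p; ring
        | cons j B =>
          -- A shuffle starts with `i` or with `j`; accordingly the letter `true` belongs to the
          -- left or to the right subword.
          rw [shuffle_cons_cons, Multiset.map_add, Multiset.sum_add, Multiset.map_map,
            Multiset.map_map]
          simp only [Function.comp_def]
          rw [hcons, hcons, ih, ih, ← Multiset.sum_map_mul_left, ← Multiset.sum_map_mul_left]
          refine congrArg₂ (· + ·) ?_ ?_ <;>
            refine congrArg Multiset.sum (Multiset.map_congr rfl fun p _ => ?_)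
          · rw [egf]; ring
          · rw [egf.eq_5 k p.2 j B]; ring

/-- A word which contributes to the generating function ends in the letter `true`. -/
lemma egf_append_false (w : List Bool) (A : List ℕ) : egf k (w ++ [false]) A = 0 := by
  induction w generalizing A with
  -- The last letter differentiates the constant `egf [] A`; the resulting 0 survives all earlier
  -- letters.
  | nil => cases A <;> simp [egf]
  | cons x w ih => cases x <;> cases A <;> simp [egf, ih]

lemma egf_replicate_false_append (m : ℕ) (w : List Bool) (A : List ℕ) :
    egf k (List.replicate m false ++ w) A = derivative^[m] (egf k w A) := by
  induction m with
  | zero => rfl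
  | succ m ih => rw [List.replicate_succ, List.cons_append, egf, ih, Function.iterate_succ_apply']

/-- The binary word of a list of positive integers. -/
def listWord (l : List ℕ) : List Bool :=
  l.flatMap fun i => List.replicate (i - 1) false ++ [true]

lemma listWord_cons (j : ℕ) (J : List ℕ) :
    listWord (j :: J) = List.replicate (j - 1) false ++ true :: listWord J := by
  simp [listWord]

lemma length_listWord {l : List ℕ} (hl : ∀ i ∈ l, 0 < i) : (listWord l).length = l.sum := by
  induction l with
  | nil => rfl
  | cons i l ih =>
    have := hl i (by simp)
    rw [listWord_cons, List.length_append, List.length_cons, List.length_replicate,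
      ih fun j hj => hl j (by simp [hj]), List.sum_cons]
    omega

/-- Splittings of a binary word produce arbitrary words. This reduces them to two cases: the word of
a composition, or a word ending in `false`, on which the generating function vanishes. -/
lemma exists_listWord (w : List Bool) :
    ∃ l : List ℕ, (∀ i ∈ l, 0 < i) ∧ ∃ m, w = listWord l ++ List.replicate m false := by
  induction w with
  | nil => exact ⟨[], by simp, 0, rfl⟩
  | cons x w ih =>
    obtain ⟨l, hl, m, rfl⟩ := ih
    cases x with
    | true => exact ⟨1 :: l, by simpa using hl, m, by simp [listWord_cons]⟩
    | false =>
      cases l with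
      | nil => exact ⟨[], by simp, m + 1, by simp [listWord, List.replicate_succ]⟩
      | cons i l =>
        refine ⟨(i + 1) :: l, by simpa using fun j hj => hl j (by simp [hj]), m, ?_⟩
        obtain ⟨i, rfl⟩ : ∃ i', i = i' + 1 := ⟨i - 1, by have := hl i (by simp); omega⟩
        simp [listWord_cons, List.replicate_succ]

lemma listWord_injective {l l' : List ℕ} (hl : ∀ i ∈ l, 0 < i) (hl' : ∀ i ∈ l', 0 < i)
    (h : listWord l = listWord l') : l = l' := by
  induction l generalizing l' with
  | nil =>
    cases l' with
    | nil => rfl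
    | cons i l' => simp [listWord] at h
  | cons i l ih =>
    cases l' with
    | nil => simp [listWord] at h
    | cons j l' =>
      rw [listWord_cons, listWord_cons] at h
      -- The position of the first `true` recovers the first part.
      have key (w : List Bool) (m : ℕ) :
          (List.replicate m false ++ true :: w).idxOf true = m := by
        rw [List.idxOf_append_of_notMem (by simp)]; simp
      have hij : i - 1 = j - 1 := by rw [← key (listWord l) (i - 1), h, key]
      rw [hij, List.append_cancel_left_eq, List.cons.injEq] at h
      have := hl i (by simp)
      have := hl' j (by simp)
      rw [ih (fun x hx => hl x (by simp [hx])) (fun x hx => hl' x (by simp [hx])) h.2]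
      congr 1
      omega

/-- The number of set partitions with blocks of sizes `A` whose maxima are given by `J`, when `m`
additional elements precede all others. -/
def numPartitions : ℕ → List ℕ → List ℕ → ℕ
  | m, [], [] => if m = 0 then 1 else 0
  | _, [], _ :: _ => 0
  | _, _ :: _, [] => 0
  | m, j :: J, i :: A => (m + j - 1).choose (i - 1) * numPartitions (m + j - i) J A

/-- The generating function records x^m/m! for `m` waiting elements, so the m-th derivative at 0
extracts that count. The statement has general `m` because each block leaves elements waiting for
the later ones. -/
lemma eval_iterate_derivative_egf [CharZero k] (m : ℕ) (J A : List ℕ) (hJ : ∀ j ∈ J, 0 < j)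
    (hA : ∀ i ∈ A, 0 < i) :
    (derivative^[m] (egf k (listWord J) A)).eval 0 = numPartitions m J A := by
  induction J generalizing m A with
  | nil =>
    cases A with
    | nil => cases m <;> simp [egf, listWord, numPartitions]
    | cons i A => simp [egf, listWord, numPartitions]
  | cons j J ih =>
    have hj := hJ j (by simp)
    have hJ' : ∀ x ∈ J, 0 < x := fun x hx => hJ x (by simp [hx])
    rw [listWord_cons, egf_replicate_false_append, ← Function.iterate_add_apply]
    cases A with
    | nil => simp [egf, numPartitions]
    | cons i A =>
      have hi := hA i (by simp)
      have hA' : ∀ x ∈ A, 0 < x := fun x hx => hA x (by simp [hx])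
      obtain ⟨i, rfl⟩ : ∃ i', i = i' + 1 := ⟨i - 1, by omega⟩
      obtain ⟨j, rfl⟩ : ∃ i', j = i' + 1 := ⟨j - 1, by omega⟩
      have key (n : ℕ) (p : k[X]) : (derivative^[n] p).eval 0 = n.factorial * p.coeff n := by
        rw [← coeff_zero_eq_eval_zero, coeff_iterate_derivative]
        simp [Nat.descFactorial_self]
      rw [key, egf, mul_assoc, coeff_C_mul, coeff_X_pow_mul']
      simp only [numPartitions, Nat.add_sub_cancel, Nat.cast_mul]
      rw [← ih (m + (j + 1) - (i + 1)) A hJ' hA', key,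
        show m + (j + 1) - 1 = m + j by omega, show m + (j + 1) - (i + 1) = m + j - i by omega]
      split_ifs with h
      -- The factorials (m+j)!, 1/i! and 1/(m+j-i)! combine into the binomial coefficient that
      -- counts the choices for the block.
      · rw [Nat.cast_choose k h]
        have := Nat.cast_ne_zero (R := k).2 (m + j - i).factorial_ne_zero
        have := Nat.cast_ne_zero (R := k).2 i.factorial_ne_zero
        field_simp
      · rw [Nat.choose_eq_zero_of_lt (by omega)]; simp

lemma numPartitions_zero_self {J : List ℕ} (hJ : ∀ j ∈ J, 0 < j) :
    numPartitions 0 J J = 1 := by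
  induction J with
  | nil => rfl
  | cons j J ih => simp [numPartitions, ih fun x hx => hJ x (by simp [hx])]

/-- The first block lies within the first `j` elements, so `i ≤ j`; if `i = j`, nothing is left
waiting and the argument repeats. With `numPartitions_zero_self` this is the unitriangularity of
`c`. -/
lemma le_of_numPartitions_ne_zero {J A : List ℕ} (hJ : ∀ j ∈ J, 0 < j) (hA : ∀ i ∈ A, 0 < i)
    (h : numPartitions 0 J A ≠ 0) : A ≤ J := by
  induction J generalizing A with
  | nil => cases A <;> simp_all [numPartitions]
  | cons j J ih =>
    cases A with
    | nil => simp_all [numPartitions]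
    | cons i A =>
      have hj := hJ j (by simp)
      have hi := hA i (by simp)
      simp only [numPartitions, zero_add, ne_eq, mul_eq_zero, not_or] at h
      have hij : i - 1 ≤ j - 1 := by
        by_contra hlt
        exact h.1 (Nat.choose_eq_zero_of_lt (by omega))
      rcases (show i ≤ j by omega).lt_or_eq with hlt | rfl
      · exact le_of_lt (show i :: A < j :: J from List.Lex.rel hlt)
      · rw [Nat.sub_self] at h
        exact List.cons_le_cons _ (ih (fun x hx => hJ x (by simp [hx]))
          (fun x hx => hA x (by simp [hx])) h.2)

end Egf

end NCSF

namespace NCSF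

/-! ### Counting set partitions -/

section Count

/-- Partial sums of a list, starting from `p`. -/
def psums : ℕ → List ℕ → List ℕ
  | _, [] => []
  | p, j :: J => (p + j) :: psums (p + j) J

lemma diffs_psums (p : ℕ) (J : List ℕ) : diffs p (psums p J) = J := by
  induction J generalizing p with
  | nil => rfl
  | cons j J ih => simp [psums, diffs, ih]

lemma psums_diffs {p : ℕ} {l : List ℕ} (hl : (p :: l).Pairwise (· ≤ ·)) :
    psums p (diffs p l) = l := by
  induction l generalizing p with
  | nil => rfl
  | cons m l ih =>
    rw [List.pairwise_cons] at hl
    have h : p + (m - p) = m := by have := hl.1 m (by simp); omega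
    simp only [diffs, psums, h]
    rw [ih hl.2]

lemma pairwise_psums (p : ℕ) {J : List ℕ} (hJ : ∀ j ∈ J, 0 < j) :
    (p :: psums p J).Pairwise (· < ·) := by
  induction J generalizing p with
  | nil => simp [psums]
  | cons j J ih =>
    have h := ih (p + j) fun x hx => hJ x (by simp [hx])
    have hj := hJ j (by simp)
    rw [psums, List.pairwise_cons]
    refine ⟨fun x hx => ?_, h⟩
    rcases List.mem_cons.1 hx with rfl | hx
    · omega
    · have := (List.pairwise_cons.1 h).1 x hx; omega

variable {n : ℕ}

/-- The candidates for a block of size `i` inside `s` with maximal element `p - 1`. -/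
def blockCandidates (s : Finset (Fin n)) (p i : ℕ) : Finset (Finset (Fin n)) :=
  s.powerset.filter fun B => B.card = i ∧ ∃ m ∈ B, (m : ℕ) + 1 = p ∧ ∀ x ∈ B, x ≤ m

/-- The lists of blocks of the set partitions of `s` with given maxima (shifted by one) and
sizes. -/
def blockLists : Finset (Fin n) → List ℕ → List ℕ → Finset (List (Finset (Fin n)))
  | s, [], [] => if s = ∅ then {[]} else ∅
  | _, [], _ :: _ => ∅
  | _, _ :: _, [] => ∅
  | s, p :: ps, i :: A =>
      (blockCandidates s p i).biUnion fun B => (blockLists (s \ B) ps A).image (B :: ·)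

/-! ### Counting the lists of blocks. -/

lemma card_filter_lt_add {s : Finset (Fin n)} {p j m : ℕ} (hs : ∀ x : Fin n, p ≤ x → x ∈ s)
    (hm : (s.filter fun x : Fin n => (x : ℕ) < p).card = m) (hn : p + j ≤ n) :
    (s.filter fun x : Fin n => (x : ℕ) < p + j).card = m + j := by
  have h : (s.filter fun x : Fin n => (x : ℕ) < p + j) = (s.filter fun x : Fin n => (x : ℕ) < p) ∪
      Finset.univ.filter fun x : Fin n => p ≤ x ∧ (x : ℕ) < p + j := by
    ext x
    simp only [Finset.mem_filter, Finset.mem_union, Finset.mem_univ, true_and]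
    constructor
    · rintro ⟨h1, h2⟩
      by_cases h : (x : ℕ) < p
      · exact Or.inl ⟨h1, h⟩
      · exact Or.inr ⟨by omega, h2⟩
    · rintro (⟨h1, h2⟩ | ⟨h1, h2⟩)
      · exact ⟨h1, by omega⟩
      · exact ⟨hs x h1, h2⟩
  have h' : (Finset.univ.filter fun x : Fin n => p ≤ x ∧ (x : ℕ) < p + j).card = j := by
    rw [← Finset.card_map Fin.valEmbedding]
    have : (Finset.univ.filter fun x : Fin n => p ≤ x ∧ (x : ℕ) < p + j).map Fin.valEmbedding =
        Finset.Ico p (p + j) := by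
      ext x
      simp only [Finset.mem_map, Finset.mem_filter, Finset.mem_univ, true_and,
        Fin.valEmbedding_apply, Finset.mem_Ico]
      constructor
      · rintro ⟨y, hy, rfl⟩; exact hy
      · intro hx; exact ⟨⟨x, by omega⟩, hx, rfl⟩
    rw [this]; simp
  rw [h, Finset.card_union_of_disjoint, hm, h']
  rw [Finset.disjoint_left]
  intro x hx hx'
  simp only [Finset.mem_filter] at hx hx'
  omega

/-- The maximum is forced into the block; the other `i - 1` elements are chosen freely among the `m`
smaller elements of `s`. -/
lemma card_blockCandidates {s : Finset (Fin n)} {p i m : ℕ} (hi : 0 < i) (hp : p < n)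
    (hs : ⟨p, hp⟩ ∈ s) (hm : (s.filter fun x : Fin n => (x : ℕ) < p + 1).card = m + 1) :
    (blockCandidates s (p + 1) i).card = m.choose (i - 1) := by
  set a : Fin n := ⟨p, hp⟩ with ha
  set T := (s.filter fun x : Fin n => (x : ℕ) < p + 1) with hT
  have haT : a ∈ T := Finset.mem_filter.2 ⟨hs, by simp [ha]⟩
  have h : blockCandidates s (p + 1) i = ((T.erase a).powersetCard (i - 1)).image (insert a) := by
    ext B
    simp only [blockCandidates, Finset.mem_filter, Finset.mem_powerset, Finset.mem_image,
      Finset.mem_powersetCard]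
    constructor
    · rintro ⟨hB, hc, b, hb, hbp, hmax⟩
      obtain rfl : a = b := Fin.ext (by simp [ha]; omega)
      refine ⟨B.erase a, ⟨?_, by rw [Finset.card_erase_of_mem hb, hc]⟩, Finset.insert_erase hb⟩
      refine Finset.erase_subset_erase _ fun x hx => ?_
      have : (x : ℕ) ≤ a := hmax x hx
      exact Finset.mem_filter.2 ⟨hB hx, by omega⟩
    · rintro ⟨D, ⟨hD, hc⟩, rfl⟩
      have hnot : a ∉ D := fun h => by simpa using hD h
      refine ⟨?_, by rw [Finset.card_insert_of_notMem hnot, hc]; omega, a, by simp, by simp [ha], ?_⟩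
      · refine Finset.insert_subset hs fun x hx => ?_
        exact (Finset.mem_filter.1 (Finset.mem_of_mem_erase (hD hx))).1
      · intro x hx
        rcases Finset.mem_insert.1 hx with rfl | hx
        · exact le_rfl
        · have := (Finset.mem_filter.1 (Finset.mem_of_mem_erase (hD hx))).2
          rw [Fin.le_def, ha]; dsimp only; omega
  rw [h, Finset.card_image_of_injOn, Finset.card_powersetCard, Finset.card_erase_of_mem haT, hm]
  · rfl
  · intro D hD D' hD' hDD
    rw [Finset.mem_coe, Finset.mem_powersetCard] at hD hD'
    have hnot : a ∉ D := fun h => by simpa using hD.1 h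
    have hnot' : a ∉ D' := fun h => by simpa using hD'.1 h
    rw [← Finset.erase_insert hnot, ← Finset.erase_insert hnot']
    exact congrArg (Finset.erase · a) hDD

/-- The invariant: `s` still contains everything from `p` on, and `m` of its elements below `p` are
waiting. Removing a block with maximum below `p + j` preserves it, with `m + j - i` elements
waiting. -/
lemma card_blockLists {J A : List ℕ} (hJ : ∀ j ∈ J, 0 < j) (hA : ∀ i ∈ A, 0 < i) {p m : ℕ}
    {s : Finset (Fin n)} (hs : ∀ x : Fin n, p ≤ x → x ∈ s)
    (hm : (s.filter fun x : Fin n => (x : ℕ) < p).card = m) (hn : p + J.sum = n) :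
    (blockLists s (psums p J) A).card = numPartitions m J A := by
  induction J generalizing A p m s with
  | nil =>
    cases A with
    | nil =>
      have : (s.filter fun x : Fin n => (x : ℕ) < p) = s := by
        refine Finset.filter_true_of_mem fun x _ => ?_
        have := x.2
        simp only [List.sum_nil] at hn
        omega
      rw [this] at hm
      simp only [psums, blockLists, numPartitions, ← hm, Finset.card_eq_zero]
      split_ifs <;> rfl
    | cons i A => rfl
  | cons j J ih =>
    cases A with
    | nil => rfl
    | cons i A =>
      have hj := hJ j (by simp)
      have hi := hA i (by simp)
      rw [List.sum_cons] at hn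
      have hT := card_filter_lt_add hs hm (j := j) (by omega)
      rw [psums, blockLists, Finset.card_biUnion]
      · have hcard : ∀ B ∈ blockCandidates s (p + j) i,
            ((blockLists (s \ B) (psums (p + j) J) A).image (B :: ·)).card =
              numPartitions (m + j - i) J A := by
          intro B hB
          rw [Finset.card_image_of_injective _ List.cons_injective]
          simp only [blockCandidates, Finset.mem_filter, Finset.mem_powerset] at hB
          obtain ⟨hBs, hBc, b, hb, hbp, hmax⟩ := hB
          have hlt : ∀ x ∈ B, (x : ℕ) < p + j := fun x hx => by
            have : (x : ℕ) ≤ b := hmax x hx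
            omega
          refine ih (fun x hx => hJ x (by simp [hx])) (fun x hx => hA x (by simp [hx])) ?_ ?_
            (by omega)
          · intro x hx
            refine Finset.mem_sdiff.2 ⟨hs x (by omega), fun hxB => ?_⟩
            have := hlt x hxB
            omega
          · have : ((s \ B).filter fun x : Fin n => (x : ℕ) < p + j) =
                (s.filter fun x : Fin n => (x : ℕ) < p + j) \ B := by
              ext x; simp only [Finset.mem_filter, Finset.mem_sdiff]; tauto
            rw [this, Finset.card_sdiff_of_subset, hT, hBc]
            exact fun x hx => Finset.mem_filter.2 ⟨hBs hx, hlt x hx⟩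
        rw [Finset.sum_congr rfl hcard, Finset.sum_const, smul_eq_mul, numPartitions]
        congr 1
        obtain ⟨j, rfl⟩ : ∃ j', j = j' + 1 := ⟨j - 1, by omega⟩
        rw [← add_assoc, card_blockCandidates hi (show p + j < n by omega) (hs _ (by simp))
          (m := m + j) (by rw [add_assoc, hT, add_assoc])]
        congr 1
      · intro B _ B' _ hne
        rw [Function.onFun, Finset.disjoint_left]
        intro l hl hl'
        rw [Finset.mem_image] at hl hl'
        obtain ⟨x, -, rfl⟩ := hl
        obtain ⟨y, -, hy⟩ := hl'
        exact hne (List.cons.inj hy).1.symm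

lemma map_mem_blockLists {ms : List (Fin n)} {P : Fin n → Finset (Fin n)} {s : Finset (Fin n)}
    (hmax : ∀ m ∈ ms, m ∈ P m ∧ ∀ x ∈ P m, x ≤ m)
    (hdisj : ms.Pairwise fun a b => Disjoint (P a) (P b)) (hs : ∀ x, x ∈ s ↔ ∃ m ∈ ms, x ∈ P m) :
    ms.map P ∈ blockLists s (ms.map fun m : Fin n => (m : ℕ) + 1) (ms.map fun m => (P m).card) := by
  induction ms generalizing s with
  | nil =>
    have : s = ∅ := Finset.eq_empty_of_forall_notMem fun x hx => by simpa using (hs x).1 hx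
    simp [blockLists, this]
  | cons m ms ih =>
    rw [List.pairwise_cons] at hdisj
    simp only [List.map_cons, blockLists, Finset.mem_biUnion, Finset.mem_image]
    refine ⟨P m, ?_, ms.map P, ih (fun a ha => hmax a (by simp [ha])) hdisj.2 ?_, rfl⟩
    · simp only [blockCandidates, Finset.mem_filter, Finset.mem_powerset]
      exact ⟨fun x hx => (hs x).2 ⟨m, by simp, hx⟩, trivial, m, (hmax m (by simp)).1, rfl,
        (hmax m (by simp)).2⟩
    · intro x
      rw [Finset.mem_sdiff, hs]
      constructor
      · rintro ⟨⟨a, ha, hx⟩, hxm⟩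
        rcases List.mem_cons.1 ha with rfl | ha
        · exact absurd hx hxm
        · exact ⟨a, ha, hx⟩
      · rintro ⟨a, ha, hx⟩
        exact ⟨⟨a, by simp [ha], hx⟩, Finset.disjoint_right.1 (hdisj.1 a ha) hx⟩

lemma exists_of_mem_blockLists {Bs : List (Finset (Fin n))} {s : Finset (Fin n)} {ps A : List ℕ}
    (h : Bs ∈ blockLists s ps A) :
    ∃ ms : List (Fin n), (ms.map fun m : Fin n => (m : ℕ) + 1) = ps ∧
      List.Forall₂ (fun m B => m ∈ B ∧ ∀ x ∈ B, x ≤ m) ms Bs ∧ Bs.map Finset.card = A ∧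
      Bs.Pairwise Disjoint ∧ ∀ x, x ∈ s ↔ ∃ B ∈ Bs, x ∈ B := by
  induction ps generalizing s A Bs with
  | nil =>
    cases A with
    | nil =>
      simp only [blockLists] at h
      split_ifs at h with hs
      · obtain rfl := Finset.mem_singleton.1 h
        exact ⟨[], by simp [hs]⟩
      · simp at h
    | cons i A => simp [blockLists] at h
  | cons p ps ih =>
    cases A with
    | nil => simp [blockLists] at h
    | cons i A =>
      simp only [blockLists, Finset.mem_biUnion, Finset.mem_image, blockCandidates,
        Finset.mem_filter, Finset.mem_powerset] at h
      obtain ⟨B, ⟨hBs, hBc, b, hb, hbp, hmax⟩, Bs, hmem, rfl⟩ := h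
      obtain ⟨ms, h1, h2, h3, h4, h5⟩ := ih hmem
      refine ⟨b :: ms, by simp [h1, hbp], .cons ⟨hb, hmax⟩ h2, by simp [h3, hBc],
        List.pairwise_cons.2 ⟨fun D hD => ?_, h4⟩, fun x => ?_⟩
      · rw [Finset.disjoint_right]
        exact fun x hx => (Finset.mem_sdiff.1 ((h5 x).2 ⟨D, hD, hx⟩)).2
      · simp only [List.mem_cons, exists_eq_or_imp, ← h5, Finset.mem_sdiff]
        have := @hBs x
        tauto

/-! ### Set partitions as lists of blocks. -/

lemma compC_eq (π : Finpartition (Finset.univ : Finset (Fin n))) :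
    compC π = diffs 0 ((blockMaxima π).map fun m : Fin n => (m : ℕ) + 1) := by
  simp [compC, ← List.map_eq_flatMap, Function.comp_def]

lemma mem_blockMaxima {π : Finpartition (Finset.univ : Finset (Fin n))} {m : Fin n} :
    m ∈ blockMaxima π ↔ ∀ j ∈ π.part m, j ≤ m := by
  simp [blockMaxima]

lemma exists_blockMaxima_of_mem_parts {π : Finpartition (Finset.univ : Finset (Fin n))}
    {B : Finset (Fin n)} (hB : B ∈ π.parts) : ∃ m ∈ blockMaxima π, π.part m = B := by
  have hne := π.nonempty_of_mem_parts hB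
  have h := π.part_eq_of_mem hB (B.max'_mem hne)
  exact ⟨B.max' hne, mem_blockMaxima.2 fun j hj => B.le_max' j (h ▸ hj), h⟩

/-- The list of the blocks, ordered by increasing maxima. -/
def blockList (π : Finpartition (Finset.univ : Finset (Fin n))) : List (Finset (Fin n)) :=
  (blockMaxima π).map π.part

lemma toFinset_blockList (π : Finpartition (Finset.univ : Finset (Fin n))) :
    (blockList π).toFinset = π.parts := by
  ext B
  simp only [blockList, List.mem_toFinset, List.mem_map]
  constructor
  · rintro ⟨m, -, rfl⟩
    exact π.part_mem.2 (Finset.mem_univ m)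
  · exact exists_blockMaxima_of_mem_parts

lemma pairwise_blockMaxima (π : Finpartition (Finset.univ : Finset (Fin n))) :
    (blockMaxima π).Pairwise (· < ·) :=
  (Finset.sortedLT_sort _).pairwise

lemma blockList_mem_blockLists (π : Finpartition (Finset.univ : Finset (Fin n))) :
    blockList π ∈ blockLists Finset.univ (psums 0 (compC π)) (compK π) := by
  rw [compC_eq, psums_diffs, compK, blockList]
  · refine map_mem_blockLists (fun m hm => ⟨π.mem_part (Finset.mem_univ m),
      mem_blockMaxima.1 hm⟩) ((pairwise_blockMaxima π).imp_of_mem fun {a b} ha hb hab => ?_) ?_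
    · refine π.disjoint (π.part_mem.2 (Finset.mem_univ a)) (π.part_mem.2 (Finset.mem_univ b)) ?_
      intro h
      -- In a common block, `b` would exceed the maximum `a`.
      have : b ∈ π.part a := h ▸ π.mem_part (Finset.mem_univ b)
      exact absurd (mem_blockMaxima.1 ha b this) (not_le.2 hab)
    · intro x
      simp only [Finset.mem_univ, true_iff]
      obtain ⟨m, hm, h⟩ := exists_blockMaxima_of_mem_parts (π.part_mem.2 (Finset.mem_univ x))
      exact ⟨m, hm, h ▸ π.mem_part (Finset.mem_univ x)⟩
  · refine List.pairwise_cons.2 ⟨by simp, List.pairwise_map.2 ?_⟩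
    refine (pairwise_blockMaxima π).imp fun {a b} hab => ?_
    have : (a : ℕ) < b := hab
    omega

/-- The blocks in the list are nonempty, disjoint and cover everything, hence form a set partition.
Positivity of `J` makes the prescribed maxima increase, so sorting the maxima returns the blocks in
the given order. -/
lemma exists_of_mem_blockLists_univ {Bs : List (Finset (Fin n))} {J A : List ℕ}
    (hJ : ∀ j ∈ J, 0 < j) (h : Bs ∈ blockLists Finset.univ (psums 0 J) A) :
    ∃ π : Finpartition (Finset.univ : Finset (Fin n)),
      compK π = A ∧ compC π = J ∧ blockList π = Bs := by
  obtain ⟨ms, h1, h2, h3, h4, h5⟩ := exists_of_mem_blockLists h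
  have hsorted : ms.Pairwise (· < ·) := by
    have := (List.pairwise_cons.1 (pairwise_psums 0 hJ)).2
    rw [← h1, List.pairwise_map] at this
    exact this.imp fun {a b} hab => by rw [Fin.lt_def]; omega
  have hright : ∀ B ∈ Bs, ∃ m ∈ ms, m ∈ B ∧ ∀ x ∈ B, x ≤ m := by
    clear h1 h3 h4 h5 hsorted h
    induction h2 with
    | nil => simp
    | cons hab _ ih =>
      intro D hD
      rcases List.mem_cons.1 hD with rfl | hD
      · exact ⟨_, by simp, hab⟩
      · obtain ⟨m, hm, hmD⟩ := ih D hD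
        exact ⟨m, by simp [hm], hmD⟩
  let π : Finpartition (Finset.univ : Finset (Fin n)) :=
    { parts := Bs.toFinset
      supIndep := by
        rw [Finset.supIndep_iff_pairwiseDisjoint]
        intro B hB D hD hne
        rw [Finset.mem_coe, List.mem_toFinset] at hB hD
        have : Std.Symm (Disjoint (α := Finset (Fin n))) := ⟨fun _ _ h => h.symm⟩
        exact h4.forall hB hD hne
      sup_parts := by
        ext x
        simpa [Finset.mem_sup] using (h5 x).1 (Finset.mem_univ x)
      bot_notMem := by
        intro hbot
        obtain ⟨m, -, hm, -⟩ := hright _ (List.mem_toFinset.1 hbot)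
        simp at hm }
  have hpart : ∀ {m B}, B ∈ Bs → m ∈ B → π.part m = B := fun hB hm =>
    π.part_eq_of_mem (List.mem_toFinset.2 hB) hm
  have hmap : ms.map π.part = Bs := by
    have hpart' : ∀ B ∈ Bs, ∀ m ∈ B, π.part m = B := fun B hB m hm => hpart hB hm
    clear_value π
    clear h1 h3 h4 h5 hsorted h hright hpart
    induction h2 with
    | nil => rfl
    | cons hab _ ih =>
      rw [List.map_cons, hpart' _ (by simp) _ hab.1, ih fun B hB => hpart' B (by simp [hB])]
  have hmaxima : blockMaxima π = ms := by
    have hset : (Finset.univ.filter fun m : Fin n => ∀ j ∈ π.part m, j ≤ m) = ms.toFinset := by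
      ext m
      simp only [Finset.mem_filter, Finset.mem_univ, true_and, List.mem_toFinset]
      constructor
      · intro hm
        have hmB : π.part m ∈ Bs := List.mem_toFinset.1 (π.part_mem.2 (Finset.mem_univ m))
        obtain ⟨a, ha, haB, hmax⟩ := hright _ hmB
        rwa [le_antisymm (hmax m (π.mem_part (Finset.mem_univ m))) (hm a haB)]
      · intro hm
        have hmB : π.part m ∈ Bs := hmap ▸ List.mem_map.2 ⟨m, hm, rfl⟩
        obtain ⟨a, ha, haB, hmax⟩ := hright _ hmB
        -- The blocks in the list are distinct, being disjoint and nonempty, so two listed maxima of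
        -- the same block coincide.
        have haa : a = m := by
          have hnd : Bs.Nodup := by
            refine List.Pairwise.imp_of_mem ?_ h4
            intro D E hD _ hDE
            rintro rfl
            obtain ⟨x, -, hx, -⟩ := hright D hD
            exact Finset.disjoint_left.1 hDE hx hx
          rw [← hmap] at hnd
          exact List.inj_on_of_nodup_map hnd ha hm (hpart hmB haB)
        exact haa ▸ hmax
    rw [blockMaxima, hset]
    exact (List.toFinset_sort _ (hsorted.imp ne_of_lt)).2 (hsorted.imp le_of_lt)
  refine ⟨π, ?_, ?_, by rw [blockList, hmaxima, hmap]⟩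
  · rw [compK, hmaxima, ← h3, ← hmap, List.map_map]; rfl
  · rw [compC_eq, hmaxima, h1, diffs_psums]

/-- A set partition is determined by the list of its blocks in order of their maxima, and
`blockLists` enumerates exactly these lists. -/
lemma c_eq_numPartitions (I J : Composition n) :
    c I J = numPartitions 0 J.blocks I.blocks := by
  have hcard : (blockLists (Finset.univ : Finset (Fin n)) (psums 0 J.blocks) I.blocks).card =
      numPartitions 0 J.blocks I.blocks :=
    card_blockLists (fun _ => J.blocks_pos) (fun _ => I.blocks_pos) (fun _ _ => Finset.mem_univ _)
      (by simp) (by rw [J.blocks_sum, zero_add])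
  rw [← hcard, c]
  refine Finset.card_bij (fun π _ => blockList π) ?_ ?_ ?_
  · intro π hπ
    obtain ⟨hK, hC⟩ := (Finset.mem_filter.1 hπ).2
    rw [← hK, ← hC]
    exact blockList_mem_blockLists π
  · intro π _ π' _ h
    exact Finpartition.ext (by rw [← toFinset_blockList, h, toFinset_blockList])
  · intro Bs hBs
    obtain ⟨π, hK, hC, hB⟩ := exists_of_mem_blockLists_univ (fun _ => J.blocks_pos) hBs
    exact ⟨π, by simp [hK, hC], hB⟩

end Count

end NCSF

namespace NCSF

/-! ### The basis `X` and its coproduct -/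

/-- Translates sums over compositions weighted by shuffle multiplicities into sums over the multiset
of shuffles or splittings. -/
lemma sum_count_smul {ι β M : Type*} [Fintype ι] [DecidableEq β] [AddCommMonoid M] {e : ι → β}
    (he : Function.Injective e) (s : Multiset β) (hs : ∀ b ∈ s, ∃ i, e i = b) (g : β → M) :
    ∑ i, s.count (e i) • g (e i) = (s.map g).sum := by
  classical
  rw [Finset.sum_multiset_map_count, ← Finset.sum_image (s := Finset.univ) (g := e)
    (f := fun b => s.count b • g b) (he.injOn)]
  symm
  refine Finset.sum_subset (fun b hb => ?_) fun b _ hb => ?_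
  · obtain ⟨i, rfl⟩ := hs b (Multiset.mem_toFinset.1 hb)
    simp
  · rw [Multiset.mem_toFinset] at hb
    rw [Multiset.count_eq_zero_of_notMem hb, zero_smul]

lemma sum_map_ite_eq_count {β M : Type*} [DecidableEq β] [AddCommMonoidWithOne M] (s : Multiset β)
    (b : β) : (s.map fun x => if x = b then (1 : M) else 0).sum = s.count b := by
  induction s using Multiset.induction_on with
  | empty => simp
  | cons a s ih =>
    rw [Multiset.map_cons, Multiset.sum_cons, ih, Multiset.count_cons]
    by_cases h : a = b <;> simp [h, eq_comm (a := b), add_comm]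

lemma exists_composition {l : List ℕ} (hl : ∀ i ∈ l, 0 < i) {n : ℕ} (hn : l.sum = n) :
    ∃ I : Composition n, I.blocks = l :=
  ⟨⟨l, fun {_} h => hl _ h, hn⟩, rfl⟩

lemma blocks_injective (n : ℕ) : Function.Injective (Composition.blocks (n := n)) :=
  fun _ _ => Composition.ext

lemma comp_ext {I J : Comp} (h : I.2.blocks = J.2.blocks) : I = J := by
  obtain ⟨m, I⟩ := I
  obtain ⟨n, J⟩ := J
  obtain rfl : m = n := by rw [← I.blocks_sum, ← J.blocks_sum]; exact congrArg List.sum h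
  rw [Composition.ext (show I.blocks = J.blocks from h)]

/-- Every block uses up waiting elements and none may remain, so sizes and gaps have matching
totals. This kills the terms of wrong degree. -/
lemma sum_eq_of_numPartitions_ne_zero {m : ℕ} {J A : List ℕ} (hJ : ∀ j ∈ J, 0 < j)
    (hA : ∀ i ∈ A, 0 < i) (h : numPartitions m J A ≠ 0) : m + J.sum = A.sum := by
  induction J generalizing m A with
  | nil => cases A <;> simp_all [numPartitions]
  | cons j J ih =>
    cases A with
    | nil => simp [numPartitions] at h
    | cons i A =>
      simp only [numPartitions, ne_eq, mul_eq_zero, not_or] at h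
      have h' := ih (fun x hx => hJ x (by simp [hx])) (fun x hx => hA x (by simp [hx])) h.2
      have hj := hJ j (by simp)
      have hi := hA i (by simp)
      have hle : i - 1 ≤ m + j - 1 := by
        by_contra hlt
        exact h.1 (Nat.choose_eq_zero_of_lt (by omega))
      rw [List.sum_cons, List.sum_cons, ← h']
      omega

lemma length_binaryWord {n : ℕ} (I : Composition n) : (binaryWord I).length = n :=
  (length_listWord fun _ => I.blocks_pos).trans I.blocks_sum

lemma binaryWord_inj {m n : ℕ} {I : Composition m} {J : Composition n} :
    binaryWord I = binaryWord J ↔ (⟨m, I⟩ : Comp) = ⟨n, J⟩ := by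
  constructor
  · exact fun h => comp_ext (listWord_injective (fun _ => I.blocks_pos) (fun _ => J.blocks_pos) h)
  · intro h; cases h; rfl

section Basis

variable {k : Type*} [Field k] (V : Module.Basis Comp k (NSym k))

lemma repr_binaryX (A J : Comp) :
    V.repr (binaryX V J) A = numPartitions 0 J.2.blocks A.2.blocks := by
  obtain ⟨n, J⟩ := J
  obtain ⟨m, A⟩ := A
  simp only [binaryX, map_sum, map_nsmul, Module.Basis.repr_self, Finsupp.coe_finsetSum,
    Finset.sum_apply, Finsupp.smul_apply]
  by_cases h : m = n
  · subst h
    rw [Finset.sum_eq_single A]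
    · simp [c_eq_numPartitions]
    · intro B _ hB
      rw [Finsupp.single_eq_of_ne (by simpa using hB.symm), smul_zero]
    · simp
  · rw [Finset.sum_eq_zero]
    · symm
      refine (congrArg Nat.cast ?_).trans Nat.cast_zero
      by_contra h0
      have := sum_eq_of_numPartitions_ne_zero (fun _ => J.blocks_pos) (fun _ => A.blocks_pos) h0
      simp only [J.blocks_sum, A.blocks_sum] at this
      omega
    · intro B _
      rw [Finsupp.single_eq_of_ne fun heq => h (congrArg Sigma.fst heq), smul_zero]

lemma linearIndependent_binaryX [CharZero k] : LinearIndependent k (binaryX V) := by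
  classical
  rw [linearIndependent_iff']
  intro s g hg
  by_contra! hne
  have hne' : (s.filter fun J => g J ≠ 0).Nonempty := by
    obtain ⟨J, hJ, h⟩ := hne
    exact ⟨J, Finset.mem_filter.2 ⟨hJ, h⟩⟩
  -- At the lexicographically largest `J` in the relation, the coordinate at `J` sees only `binaryX
  -- V J`, with coefficient 1.
  obtain ⟨J, hJ, hmax⟩ := Finset.exists_max_image _ (fun J : Comp => J.2.blocks) hne'
  have h := congrArg (fun x => V.repr x J) hg
  simp only [map_sum, map_smul, Finsupp.coe_finsetSum, Finset.sum_apply, Finsupp.smul_apply,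
    repr_binaryX, map_zero, Finsupp.coe_zero, Pi.zero_apply] at h
  rw [Finset.mem_filter] at hJ
  rw [Finset.sum_eq_single J] at h
  · rw [numPartitions_zero_self fun _ => J.2.blocks_pos] at h
    simp [hJ.2] at h
  · intro I hI hIJ
    by_contra hne
    have hI0 : g I ≠ 0 := fun h0 => hne (by rw [h0, zero_smul])
    have hc : numPartitions 0 I.2.blocks J.2.blocks ≠ 0 := fun h0 => hne (by simp [h0])
    exact hIJ (comp_ext (le_antisymm (hmax I (Finset.mem_filter.2 ⟨hI, hI0⟩))
      (le_of_numPartitions_ne_zero (fun _ => I.2.blocks_pos) (fun _ => J.2.blocks_pos) hc)))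
  · exact fun h => absurd hJ.1 h

lemma span_binaryX : ⊤ ≤ Submodule.span k (Set.range (binaryX V)) := by
  classical
  rw [← V.span_eq, Submodule.span_le]
  rintro _ ⟨⟨n, J⟩, rfl⟩
  -- Finiteness in a fixed degree is essential: across degrees the lexicographic order has infinite
  -- descents such as [2] > [1,2] > [1,1,2] > ….
  have hwf : WellFounded fun I J : Composition n => I.blocks < J.blocks :=
    have : IsTrans (Composition n) fun I J => I.blocks < J.blocks := ⟨fun _ _ _ => lt_trans⟩
    have : Std.Irrefl fun I J : Composition n => I.blocks < J.blocks := ⟨fun _ => lt_irrefl _⟩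
    Finite.wellFounded_of_trans_of_irrefl _
  induction J using hwf.induction with
  | _ J ih =>
    have h : V ⟨n, J⟩ = binaryX V ⟨n, J⟩ -
        ∑ I ∈ Finset.univ.erase J, c I J • V ⟨n, I⟩ := by
      rw [binaryX, ← Finset.add_sum_erase _ _ (Finset.mem_univ J), c_eq_numPartitions J J,
        numPartitions_zero_self fun _ => J.blocks_pos, one_smul, add_sub_cancel_right]
    rw [h]
    refine Submodule.sub_mem _ (Submodule.subset_span ⟨_, rfl⟩) (Submodule.sum_mem _ fun I hI => ?_)
    by_cases h0 : c I J = 0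
    · rw [h0, zero_smul]; exact Submodule.zero_mem _
    · refine Submodule.smul_of_tower_mem _ _ (ih I (lt_of_le_of_ne ?_ ?_))
      · rw [c_eq_numPartitions] at h0
        exact le_of_numPartitions_ne_zero (fun _ => J.blocks_pos) (fun _ => I.blocks_pos) h0
      · exact fun h => (Finset.mem_erase.1 hI).1 (Composition.ext h)

/-- The basis `X` attached to a basis `V`. -/
noncomputable def binaryBasis [CharZero k] : Module.Basis Comp k (NSym k) :=
  Module.Basis.mk (linearIndependent_binaryX V) (span_binaryX V)

@[simp] lemma binaryBasis_apply [CharZero k] (J : Comp) : binaryBasis V J = binaryX V J := by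
  simp [binaryBasis]

end Basis

section Coproduct

variable {k : Type*} [Field k] (V : Comp → NSym k)

/-- The extension of the family `X` to arbitrary words, restricted to the degree `p`. -/
noncomputable def wordX (p : ℕ) (u : List Bool) : NSym k :=
  ∑ B : Composition p, (egf k u B.blocks).eval 0 • V ⟨p, B⟩

lemma wordX_append_false (p : ℕ) (u : List Bool) : wordX V p (u ++ [false]) = 0 := by
  simp [wordX, egf_append_false]

variable [CharZero k]

lemma eval_egf_binaryWord {m n : ℕ} (J : Composition m) (I : Composition n) :
    (egf k (binaryWord J) I.blocks).eval 0 = (numPartitions 0 J.blocks I.blocks : k) :=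
  eval_iterate_derivative_egf k 0 J.blocks I.blocks (fun _ => J.blocks_pos) fun _ => I.blocks_pos

lemma wordX_binaryWord {n : ℕ} (J : Composition n) :
    wordX V n (binaryWord J) = binaryX V ⟨n, J⟩ := by
  simp only [wordX, binaryX, eval_egf_binaryWord, c_eq_numPartitions, Nat.cast_smul_eq_nsmul]

lemma wordX_binaryWord_of_ne {p n : ℕ} (h : p ≠ n) (J : Composition n) :
    wordX V p (binaryWord J) = 0 := by
  refine Finset.sum_eq_zero fun B _ => ?_
  rw [eval_egf_binaryWord]
  by_cases h0 : numPartitions 0 J.blocks B.blocks = 0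
  · simp [h0]
  · have := sum_eq_of_numPartitions_ne_zero (fun _ => J.blocks_pos) (fun _ => B.blocks_pos) h0
    rw [J.blocks_sum, B.blocks_sum] at this
    omega

/-- Compare the coefficients of `V B ⊗ V C`: on the left a sum over shuffles of `B` and `C`, on the
right a sum over splittings of the word. They agree by `sum_shuffle_egf`. -/
lemma comul_binaryX (hV : HasUnshuffleCoproduct V) {n : ℕ} (M : Composition n) :
    comul k (binaryX V ⟨n, M⟩) =
      ((splits (binaryWord M)).map fun u => ∑ p ∈ Finset.HasAntidiagonal.antidiagonal n,
        wordX V p.1 u.1 ⊗ₜ[k] wordX V p.2 u.2).sum := by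
  -- Evaluation at 0 is a ring homomorphism, so `sum_shuffle_egf` descends to the numbers.
  have key {p q : ℕ} (hpq : p + q = n) (B : Composition p) (C : Composition q) :
      ∑ A : Composition n, ((shuffle B.blocks C.blocks).count A.blocks) •
          (egf k (binaryWord M) A.blocks).eval 0 =
        ((splits (binaryWord M)).map fun u =>
          (egf k u.1 B.blocks).eval 0 * (egf k u.2 C.blocks).eval 0).sum := by
    rw [sum_count_smul (blocks_injective n) _ _ fun A => (egf k (binaryWord M) A).eval 0]
    · have := congrArg (Polynomial.evalRingHom (0 : k))
        (sum_shuffle_egf k (binaryWord M) B.blocks C.blocks)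
      rw [map_multiset_sum, map_multiset_sum, Multiset.map_map, Multiset.map_map] at this
      simpa [Function.comp_def] using this
    · intro l hl
      have hperm := perm_of_mem_shuffle hl
      refine exists_composition (fun i hi => ?_) ?_
      · rcases List.mem_append.1 (hperm.mem_iff.1 hi) with h | h
        exacts [B.blocks_pos h, C.blocks_pos h]
      · rw [hperm.sum_eq, List.sum_append, B.blocks_sum, C.blocks_sum, hpq]
  have hsum {ι : Type} (t : Finset ι) (f : List Bool × List Bool → ι → NSym k ⊗[k] NSym k) :
      ((splits (binaryWord M)).map fun u => ∑ p ∈ t, f u p).sum =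
        ∑ p ∈ t, ((splits (binaryWord M)).map fun u => f u p).sum := by
    classical
    induction t using Finset.induction_on with
    | empty => simp
    | insert a t ha ih => simp [Finset.sum_insert ha, Multiset.sum_map_add, ih]
  rw [← wordX_binaryWord, wordX, map_sum, hsum]
  simp only [map_smul, hV n, Finset.smul_sum]
  rw [Finset.sum_comm]
  refine Finset.sum_congr rfl fun p hp => ?_
  rw [Finset.HasAntidiagonal.mem_antidiagonal] at hp
  simp only [wordX, TensorProduct.sum_tmul, TensorProduct.tmul_sum, hsum]
  rw [Finset.sum_comm, Finset.sum_comm (s := (Finset.univ : Finset (Composition p.2)))]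
  refine Finset.sum_congr rfl fun B _ => ?_
  rw [Finset.sum_comm]
  refine Finset.sum_congr rfl fun C _ => ?_
  simp only [TensorProduct.smul_tmul_smul]
  have hsmul (g : List Bool × List Bool → k) (x : NSym k ⊗[k] NSym k) :
      ((splits (binaryWord M)).map fun u => g u • x).sum =
        ((splits (binaryWord M)).map g).sum • x := by
    rw [Multiset.sum_smul, Multiset.map_map]; rfl
  rw [hsmul, ← key hp B C, Finset.sum_smul]
  refine Finset.sum_congr rfl fun A _ => ?_
  rw [smul_assoc, smul_comm]

/-- For a word with trailing letters `false` both sides vanish, since a nonempty binary word ends in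
`true`; any other word is that of a composition, where duality applies. -/
lemma apply_wordX {φ : NSym k →ₗ[k] k} {m : ℕ} {I : Composition m}
    (hφ : ∀ J, φ (binaryX V J) = if (⟨m, I⟩ : Comp) = J then 1 else 0) (p : ℕ) (u : List Bool) :
    φ (wordX V p u) = if u = binaryWord I ∧ p = m then 1 else 0 := by
  obtain ⟨l, hl, r, rfl⟩ := exists_listWord u
  cases r with
  | succ r =>
    have hend : listWord l ++ List.replicate (r + 1) false ≠ binaryWord I := by
      intro h
      have hI : binaryWord I = [] ∨ ∃ w, binaryWord I = w ++ [true] := by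
        rcases List.eq_nil_or_concat I.blocks with h | ⟨w, i, h⟩
        · left; simp [binaryWord, h]
        · right
          exact ⟨listWord w ++ List.replicate (i - 1) false, by simp [binaryWord, listWord, h]⟩
      rw [List.replicate_succ', ← List.append_assoc] at h
      rcases hI with hI | ⟨w, hI⟩
      · simp [hI] at h
      · rw [hI] at h
        simpa using (List.append_inj' h rfl).2
    rw [if_neg fun h => hend h.1, List.replicate_succ', ← List.append_assoc, wordX_append_false,
      map_zero]
  | zero =>
    obtain ⟨n, hn⟩ : ∃ n, l.sum = n := ⟨_, rfl⟩
    obtain ⟨J, rfl⟩ := exists_composition hl hn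
    rw [List.replicate_zero, List.append_nil]
    change φ (wordX V p (binaryWord J)) = if binaryWord J = binaryWord I ∧ p = m then 1 else 0
    by_cases hp : p = n
    · subst hp
      rw [wordX_binaryWord, hφ]
      refine if_congr ?_ rfl rfl
      rw [binaryWord_inj, eq_comm]
      exact ⟨fun h => ⟨h, congrArg Sigma.fst h⟩, fun h => h.1⟩
    · rw [wordX_binaryWord_of_ne V hp, map_zero, if_neg]
      rintro ⟨h, rfl⟩
      exact hp (congrArg Sigma.fst (binaryWord_inj.1 h)).symm

/-- The product of two functionals dual to the basis `X`. -/
lemma mul_dual_comul_binaryX (hV : HasUnshuffleCoproduct V) {φ ψ : NSym k →ₗ[k] k} {m n : ℕ}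
    {I : Composition m} {J : Composition n}
    (hφ : ∀ K, φ (binaryX V K) = if (⟨m, I⟩ : Comp) = K then 1 else 0)
    (hψ : ∀ K, ψ (binaryX V K) = if (⟨n, J⟩ : Comp) = K then 1 else 0) (M : Comp) :
    LinearMap.mul' k k (TensorProduct.map φ ψ (comul k (binaryX V M))) =
      (shuffle (binaryWord I) (binaryWord J)).count (binaryWord M.2) := by
  obtain ⟨N, M⟩ := M
  rw [comul_binaryX V hV, map_multiset_sum, map_multiset_sum, Multiset.map_map, Multiset.map_map,
    ← count_splits, ← sum_map_ite_eq_count]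
  refine congrArg Multiset.sum (Multiset.map_congr rfl fun u hu => ?_)
  have hlen := length_add_length_of_mem_splits hu
  rw [length_binaryWord] at hlen
  simp only [Function.comp_apply, map_sum, TensorProduct.map_tmul, LinearMap.mul'_apply,
    apply_wordX V hφ, apply_wordX V hψ]
  split_ifs with h
  · obtain ⟨u, v⟩ := u
    obtain ⟨rfl, rfl⟩ := Prod.mk.inj h
    simp only [length_binaryWord] at hlen
    -- Only the bidegree `(m, n)` contributes; it occurs in the sum because the lengths of the two
    -- subwords add up to `N`.
    rw [Finset.sum_eq_single (m, n)]
    · simp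
    · rintro ⟨a, b⟩ - hab
      simp only [true_and]
      by_cases ha : a = m
      · rw [if_neg (c := b = n) fun hb => hab (Prod.ext ha hb), mul_zero]
      · rw [if_neg ha, zero_mul]
    · exact fun h => absurd (Finset.HasAntidiagonal.mem_antidiagonal.2 hlen) h
  · refine Finset.sum_eq_zero fun p _ => ?_
    by_cases h1 : u.1 = binaryWord I
    · rw [if_neg (c := u.2 = _ ∧ _) fun h2 => h (Prod.ext h1 h2.1), mul_zero]
    · rw [if_neg fun h2 => h1 h2.1, zero_mul]

end Coproduct

end NCSF

namespace NCSF

/-! ### The pairing with quasi-symmetric functions -/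

section Complete

variable (k : Type*) [Field k]

lemma S_coe_pnat (i : ℕ+) : S k (i : ℕ) = FreeAlgebra.ι k i := by
  obtain ⟨n, hn⟩ : ∃ n, (i : ℕ) = n + 1 := ⟨i.natPred, by simp⟩
  rw [hn, S]
  congr 1
  exact PNat.eq (by simp [hn])

lemma comul_S (n : ℕ) :
    comul k (S k n) = ∑ p ∈ Finset.HasAntidiagonal.antidiagonal n, S k p.1 ⊗ₜ[k] S k p.2 := by
  cases n with
  | zero => simp [S, Algebra.TensorProduct.one_def]
  | succ n => rw [S, comul, FreeAlgebra.lift_ι_apply]; simp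

lemma basisFreeMonoid_apply (w : FreeMonoid ℕ+) :
    FreeAlgebra.basisFreeMonoid k ℕ+ w = (w.toList.map (FreeAlgebra.ι k)).prod := by
  change MonoidAlgebra.lift k (FreeAlgebra k ℕ+) (FreeMonoid ℕ+) (FreeMonoid.lift (FreeAlgebra.ι k))
    (MonoidAlgebra.single w 1) = _
  rw [MonoidAlgebra.lift_single, one_smul, FreeMonoid.lift_apply]

/-- Words in positive integers are compositions. -/
noncomputable def wordEquiv : FreeMonoid ℕ+ ≃ Comp :=
  Equiv.ofBijective (fun w => ⟨(w.toList.map fun i : ℕ+ => (i : ℕ)).sum,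
    ⟨w.toList.map fun i : ℕ+ => (i : ℕ), by
      intro i hi; obtain ⟨j, -, rfl⟩ := List.mem_map.1 hi; exact j.pos, rfl⟩⟩) <| by
    constructor
    · intro u v h
      have : (u.toList.map fun i : ℕ+ => (i : ℕ)) = v.toList.map fun i : ℕ+ => (i : ℕ) :=
        congrArg (fun I : Comp => I.2.blocks) h
      exact FreeMonoid.toList.injective (List.map_injective_iff.2 PNat.coe_injective this)
    · intro I
      refine ⟨FreeMonoid.ofList (I.2.blocks.map Nat.toPNat'), comp_ext ?_⟩
      simp only [FreeMonoid.toList_ofList, List.map_map]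
      conv_rhs => rw [← List.map_id I.2.blocks]
      exact List.map_congr_left fun i hi => PNat.toPNat'_coe (I.2.blocks_pos hi)

lemma blocks_wordEquiv (w : FreeMonoid ℕ+) :
    (wordEquiv w).2.blocks = w.toList.map fun i : ℕ+ => (i : ℕ) := rfl

/-- The basis `S^I` of `Sym`. -/
noncomputable def completeBasis : Module.Basis Comp k (NSym k) :=
  (FreeAlgebra.basisFreeMonoid k ℕ+).reindex wordEquiv

lemma prodFamily_wordEquiv (w : FreeMonoid ℕ+) :
    prodFamily (S k) (wordEquiv w) = FreeAlgebra.basisFreeMonoid k ℕ+ w := by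
  rw [basisFreeMonoid_apply, prodFamily, blocks_wordEquiv, List.map_map]
  congr 1
  exact List.map_congr_left fun i _ => S_coe_pnat k i

@[simp] lemma completeBasis_apply (I : Comp) : completeBasis k I = prodFamily (S k) I := by
  obtain ⟨w, rfl⟩ := wordEquiv.surjective I
  rw [completeBasis, Module.Basis.reindex_apply, Equiv.symm_apply_apply, prodFamily_wordEquiv]

end Complete

/-- The composition read off from an exponent. -/
def compress (e : ℕ →₀ ℕ) : List ℕ := (e.support.sort (· ≤ ·)).map e

lemma compress_toFinsupp (l : List ℕ) : compress l.toFinsupp = l.filter (· ≠ 0) := by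
  have h : l.toFinsupp.support = ((List.range l.length).filter (l.getD · 0 ≠ 0)).toFinset := by
    ext i; simp [List.toFinsupp_support]
  have hsort : (l.toFinsupp.support.sort (· ≤ ·)) =
      (List.range l.length).filter (l.getD · 0 ≠ 0) := by
    rw [h]
    exact (List.toFinset_sort (r := (· ≤ ·)) (List.nodup_range.filter _)).2
      ((List.pairwise_le_range).filter _)
  have hl : (List.range l.length).map (l.getD · 0) = l := by
    refine List.ext_getElem (by simp) fun i h1 h2 => ?_
    simp [h2]
  rw [compress, hsort, List.coe_toFinsupp]
  conv_rhs => rw [← hl, List.filter_map]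
  rfl

lemma exists_toFinsupp (e : ℕ →₀ ℕ) : ∃ l : List ℕ, l.toFinsupp = e := by
  refine ⟨(List.range (e.support.sup id + 1)).map e, ?_⟩
  ext i
  rw [List.toFinsupp_apply]
  by_cases hi : i < e.support.sup id + 1
  · simp [List.getD_eq_getElem?_getD, hi]
  · have : e i = 0 := by
      by_contra h
      have : i ≤ e.support.sup id := Finset.le_sup (f := id) (Finsupp.mem_support_iff.2 h)
      omega
    simp [List.getD_eq_getElem?_getD, hi, this]

lemma filter_blocks {n : ℕ} (I : Composition n) : I.blocks.filter (· ≠ 0) = I.blocks :=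
  List.filter_eq_self.2 fun i hi => by simpa using (I.blocks_pos hi).ne'

section Pairing

variable {k : Type*} [Field k]

lemma coeff_quasiMonomial (I : Comp) (e : ℕ →₀ ℕ) :
    MvPowerSeries.coeff e (quasiMonomial k I) = if compress e = I.2.blocks then 1 else 0 := rfl

/-- Quasi-symmetry: inserting or deleting zero exponents does not change a coefficient. -/
lemma coeff_eq_of_compress_eq {f : MvPowerSeries ℕ k} (hf : f ∈ QSym k) {e e' : ℕ →₀ ℕ}
    (h : compress e = compress e') : MvPowerSeries.coeff e f = MvPowerSeries.coeff e' f := by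
  induction hf using Submodule.span_induction with
  | mem x hx =>
    obtain ⟨I, rfl⟩ := hx
    rw [coeff_quasiMonomial, coeff_quasiMonomial, h]
  | zero => simp
  | add x y _ _ hx hy => rw [map_add, map_add, hx, hy]
  | smul a x _ hx => rw [map_smul, map_smul, hx]

lemma pairing_prodFamily_S (f : QSym k) (I : Comp) :
    pairing f (prodFamily (S k) I) =
      MvPowerSeries.coeff I.2.blocks.toFinsupp (f : MvPowerSeries ℕ k) := by
  obtain ⟨w, rfl⟩ := wordEquiv.surjective I
  rw [prodFamily_wordEquiv, pairing, Module.Basis.constr_basis]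
  rfl

/-- Zeros in `l` are allowed, since S_0 = 1 on one side and quasi-symmetry on the other absorb them.
They arise from the coproduct of each S_n. -/
lemma pairing_prod_S (f : QSym k) (l : List ℕ) :
    pairing f (l.map (S k)).prod = MvPowerSeries.coeff l.toFinsupp (f : MvPowerSeries ℕ k) := by
  obtain ⟨I, hI⟩ := exists_composition (l := l.filter (· ≠ 0))
    (fun i hi => Nat.pos_of_ne_zero (by simpa using (List.mem_filter.1 hi).2)) rfl
  have hprod : (l.map (S k)).prod = prodFamily (S k) ⟨_, I⟩ := by
    rw [prodFamily, hI]
    clear hI I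
    induction l with
    | nil => rfl
    | cons i l ih => cases i <;> simp_all [S]
  rw [hprod, pairing_prodFamily_S]
  refine coeff_eq_of_compress_eq f.2 ?_
  rw [compress_toFinsupp, compress_toFinsupp, filter_blocks, hI]

lemma pairing_injective : Function.Injective (pairing : QSym k → NSym k →ₗ[k] k) := by
  intro f g h
  refine Subtype.ext (MvPowerSeries.ext fun e => ?_)
  obtain ⟨l, rfl⟩ := exists_toFinsupp e
  rw [← pairing_prod_S, h, pairing_prod_S]

/-- The pairing as a bilinear map. -/
noncomputable def pairingHom : QSym k →ₗ[k] NSym k →ₗ[k] k where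
  toFun := pairing
  map_add' f g := (completeBasis k).ext fun I => by simp [pairing_prodFamily_S]
  map_smul' a f := (completeBasis k).ext fun I => by simp [pairing_prodFamily_S]

/-- The sum of `h u v` over the ways to write a list of exponents as the sum of two lists of the
same length. -/
def sumAntidiagonal {M : Type*} [AddCommMonoid M] : List ℕ → (List ℕ → List ℕ → M) → M
  | [], h => h [] []
  | i :: l, h => ∑ p ∈ Finset.HasAntidiagonal.antidiagonal i,
      sumAntidiagonal l fun u v => h (p.1 :: u) (p.2 :: v)

lemma map_sumAntidiagonal {M N F : Type*} [AddCommMonoid M] [AddCommMonoid N] [FunLike F M N]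
    [AddMonoidHomClass F M N] (φ : F) (l : List ℕ) (h : List ℕ → List ℕ → M) :
    φ (sumAntidiagonal l h) = sumAntidiagonal l fun u v => φ (h u v) := by
  induction l generalizing h with
  | nil => rfl
  | cons i l ih => simp only [sumAntidiagonal, map_sum, ih]

lemma comul_prod_S (l : List ℕ) :
    comul k (l.map (S k)).prod =
      sumAntidiagonal l fun u v => (u.map (S k)).prod ⊗ₜ[k] (v.map (S k)).prod := by
  induction l with
  | nil => simp [sumAntidiagonal, Algebra.TensorProduct.one_def]
  | cons i l ih =>
    rw [List.map_cons, List.prod_cons, map_mul, ih, comul_S, Finset.sum_mul, sumAntidiagonal]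
    refine Finset.sum_congr rfl fun p _ => ?_
    have := map_sumAntidiagonal (LinearMap.mulLeft k (S k p.1 ⊗ₜ[k] S k p.2)) l
      fun u v => (u.map (S k)).prod ⊗ₜ[k] (v.map (S k)).prod
    simpa using this

/-- Prepend an exponent. -/
noncomputable def consExp (i : ℕ) (e : ℕ →₀ ℕ) : ℕ →₀ ℕ :=
  Finsupp.single 0 i + e.embDomain (addRightEmbedding 1)

@[simp] lemma consExp_zero (i : ℕ) (e : ℕ →₀ ℕ) : consExp i e 0 = i := by
  have : (0 : ℕ) ∉ Set.range (addRightEmbedding 1 : ℕ ↪ ℕ) := by simp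
  simp [consExp, Finsupp.embDomain_of_notMem_range _ _ _ this]

@[simp] lemma consExp_succ (i : ℕ) (e : ℕ →₀ ℕ) (n : ℕ) : consExp i e (n + 1) = e n := by
  have := Finsupp.embDomain_apply_self (addRightEmbedding 1 : ℕ ↪ ℕ) e n
  simpa [consExp] using this

lemma toFinsupp_cons (i : ℕ) (l : List ℕ) : (i :: l).toFinsupp = consExp i l.toFinsupp :=
  List.toFinsupp_cons_eq_single_add_embDomain i l

/-- The tail of an exponent. -/
noncomputable def tailExp (e : ℕ →₀ ℕ) : ℕ →₀ ℕ :=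
  e.comapDomain (· + 1) (add_left_injective 1).injOn

@[simp] lemma tailExp_apply (e : ℕ →₀ ℕ) (n : ℕ) : tailExp e n = e (n + 1) := rfl

@[simp] lemma consExp_tailExp (e : ℕ →₀ ℕ) : consExp (e 0) (tailExp e) = e := by
  ext n; cases n <;> simp

@[simp] lemma tailExp_consExp (i : ℕ) (e : ℕ →₀ ℕ) : tailExp (consExp i e) = e := by
  ext n; simp

/-- The coefficient of `x_0 ^ i`, as a power series in the remaining variables. -/
noncomputable def headCoeff (i : ℕ) (f : MvPowerSeries ℕ k) : MvPowerSeries ℕ k :=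
  fun e => MvPowerSeries.coeff (consExp i e) f

lemma coeff_headCoeff (i : ℕ) (e : ℕ →₀ ℕ) (f : MvPowerSeries ℕ k) :
    MvPowerSeries.coeff e (headCoeff i f) = MvPowerSeries.coeff (consExp i e) f := rfl

lemma coeff_consExp_mul (i : ℕ) (e : ℕ →₀ ℕ) (f g : MvPowerSeries ℕ k) :
    MvPowerSeries.coeff (consExp i e) (f * g) =
      ∑ p ∈ Finset.HasAntidiagonal.antidiagonal i,
        MvPowerSeries.coeff e (headCoeff p.1 f * headCoeff p.2 g) := by
  classical
  simp only [MvPowerSeries.coeff_mul, coeff_headCoeff]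
  rw [Finset.sum_sigma']
  refine Finset.sum_nbij' (fun q => ⟨(q.1 0, q.2 0), (tailExp q.1, tailExp q.2)⟩)
    (fun x => (consExp x.1.1 x.2.1, consExp x.1.2 x.2.2)) ?_ ?_ ?_ ?_ ?_
  · rintro ⟨a, b⟩ h
    simp only [Finset.HasAntidiagonal.mem_antidiagonal, Finset.mem_sigma] at h ⊢
    refine ⟨by simpa using DFunLike.congr_fun h 0, ?_⟩
    ext n
    simpa using DFunLike.congr_fun h (n + 1)
  · rintro ⟨⟨a, b⟩, ⟨c, d⟩⟩ h
    simp only [Finset.HasAntidiagonal.mem_antidiagonal, Finset.mem_sigma] at h ⊢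
    obtain ⟨rfl, rfl⟩ := h
    ext n; cases n <;> simp
  · rintro ⟨a, b⟩ _; simp
  · rintro ⟨⟨a, b⟩, ⟨c, d⟩⟩ _; simp
  · rintro ⟨a, b⟩ _; simp

/-- The recursion on exponents is the one of `comul_prod_S`, which makes product and coproduct dual.
-/
lemma coeff_toFinsupp_mul (l : List ℕ) (f g : MvPowerSeries ℕ k) :
    MvPowerSeries.coeff l.toFinsupp (f * g) = sumAntidiagonal l fun u v =>
      MvPowerSeries.coeff u.toFinsupp f * MvPowerSeries.coeff v.toFinsupp g := by
  induction l generalizing f g with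
  | nil => simp [sumAntidiagonal, List.toFinsupp_nil, MvPowerSeries.coeff_zero_eq_constantCoeff]
  | cons i l ih =>
    rw [toFinsupp_cons, coeff_consExp_mul, sumAntidiagonal]
    simp only [ih, coeff_headCoeff, toFinsupp_cons]

/-- The pairing turns the product of quasi-symmetric functions into the coproduct of `Sym`. -/
lemma coeff_toFinsupp_mul_eq_comul (f g : QSym k) (l : List ℕ) :
    MvPowerSeries.coeff l.toFinsupp ((f : MvPowerSeries ℕ k) * (g : MvPowerSeries ℕ k)) =
      LinearMap.mul' k k (TensorProduct.map (pairing f) (pairing g)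
        (comul k (l.map (S k)).prod)) := by
  rw [coeff_toFinsupp_mul, comul_prod_S, map_sumAntidiagonal, map_sumAntidiagonal]
  simp [pairing_prod_S]

lemma binaryShuffleRule_of_isDual [CharZero k] (V : Module.Basis Comp k (NSym k))
    (hV : HasUnshuffleCoproduct V) {Z : Comp → QSym k} (hZ : IsDual Z (binaryX V)) :
    BinaryShuffleRule Z := by
  intro m n I J
  -- The shuffle rule as an identity of functionals on Sym, which can be tested on the basis `X`.
  have key : LinearMap.mul' k k ∘ₗ
      TensorProduct.map (pairing (Z ⟨m, I⟩)) (pairing (Z ⟨n, J⟩)) ∘ₗ (comul k).toLinearMap =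
      ∑ K : Composition (m + n),
        ((shuffle (binaryWord I) (binaryWord J)).count (binaryWord K)) •
          pairing (Z ⟨m + n, K⟩) := by
    refine (binaryBasis V).ext fun M => ?_
    have h := mul_dual_comul_binaryX V hV (hZ ⟨m, I⟩) (hZ ⟨n, J⟩) M
    simp only [binaryBasis_apply, LinearMap.comp_apply, AlgHom.toLinearMap_apply, h,
      LinearMap.sum_apply, LinearMap.smul_apply, hZ _ _]
    obtain ⟨N, M⟩ := M
    by_cases hN : N = m + n
    · subst hN
      rw [Finset.sum_eq_single M]
      · simp
      · intro K _ hK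
        rw [if_neg (by simpa using hK), smul_zero]
      · simp
    · rw [Finset.sum_eq_zero, Multiset.count_eq_zero_of_notMem, Nat.cast_zero]
      · intro hmem
        have := (perm_of_mem_shuffle hmem).length_eq
        rw [List.length_append, length_binaryWord, length_binaryWord, length_binaryWord] at this
        exact hN this
      · intro K _
        rw [if_neg fun h => hN (congrArg Sigma.fst h).symm, smul_zero]
  -- The product is not presupposed to lie in QSym, so all its coefficients are compared, including
  -- those at lists `l` containing zeros.
  refine MvPowerSeries.ext fun e => ?_
  obtain ⟨l, rfl⟩ := exists_toFinsupp e
  rw [coeff_toFinsupp_mul_eq_comul]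
  have h := LinearMap.congr_fun key (l.map (S k)).prod
  simp only [LinearMap.comp_apply, AlgHom.toLinearMap_apply, LinearMap.sum_apply,
    LinearMap.smul_apply, pairing_prod_S] at h
  rw [h]
  simp only [map_sum, map_nsmul]

end Pairing

/-! ### Dual bases -/

section Dual

variable {k : Type*} [Field k]

/-- The projection of `Sym` onto the homogeneous component of degree `n`. -/
noncomputable def homogeneousProj (n : ℕ) : NSym k →ₗ[k] NSym k :=
  (completeBasis k).constr k fun J => if J.1 = n then prodFamily (S k) J else 0

lemma homogeneousProj_S (n : ℕ) (J : Comp) :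
    homogeneousProj n (prodFamily (S k) J) = if J.1 = n then prodFamily (S k) J else 0 := by
  rw [homogeneousProj, ← completeBasis_apply, Module.Basis.constr_basis, completeBasis_apply]

lemma homogeneousProj_of_mem {m n : ℕ} {x : NSym k} (hx : x ∈ homogeneous k m) :
    homogeneousProj n x = if m = n then x else 0 := by
  induction hx using Submodule.span_induction with
  | mem x hx => obtain ⟨I, rfl⟩ := hx; rw [homogeneousProj_S]
  | zero => simp
  | add x y _ _ hx hy => rw [map_add, hx, hy]; split_ifs <;> simp
  | smul a x _ hx => rw [map_smul, hx]; split_ifs <;> simp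

/-- The coordinate functional composed with the projection to another degree kills every member of
the homogeneous basis. -/
lemma coord_prodFamily_S_of_ne {X : Module.Basis Comp k (NSym k)}
    (hX : ∀ I, X I ∈ homogeneous k I.1) {I J : Comp} (h : I.1 ≠ J.1) :
    X.coord I (prodFamily (S k) J) = 0 := by
  have key : X.coord I ∘ₗ homogeneousProj J.1 = 0 := by
    refine X.ext fun K => ?_
    rw [LinearMap.comp_apply, homogeneousProj_of_mem (hX K)]
    split_ifs with hK
    · rw [X.coord_apply, X.repr_self, Finsupp.single_eq_of_ne, LinearMap.zero_apply]
      rintro rfl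
      exact h hK
    · simp
  have := LinearMap.congr_fun key (prodFamily (S k) J)
  rwa [LinearMap.comp_apply, homogeneousProj_S, if_pos rfl] at this

/-- The quasi-monomial functions as members of `QSym`. -/
def monomialQSym (I : Comp) : QSym k := ⟨quasiMonomial k I, Submodule.subset_span ⟨I, rfl⟩⟩

lemma pairing_monomialQSym (I J : Comp) :
    pairing (monomialQSym I : QSym k) (prodFamily (S k) J) = if J = I then 1 else 0 := by
  rw [pairing_prodFamily_S, monomialQSym, coeff_quasiMonomial, compress_toFinsupp, filter_blocks]
  exact if_congr ⟨comp_ext, fun h => by rw [h]⟩ rfl rfl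

lemma pairing_monomialQSym_of_mem {n : ℕ} {x : NSym k} (hx : x ∈ homogeneous k n) {I : Comp}
    (h : I.1 ≠ n) : pairing (monomialQSym I) x = 0 := by
  induction hx using Submodule.span_induction with
  | mem x hx =>
    obtain ⟨J, rfl⟩ := hx
    rw [pairing_monomialQSym, if_neg]
    rintro rfl
    exact h rfl
  | zero => simp
  | add x y _ _ hx hy => rw [map_add, hx, hy, add_zero]
  | smul a x _ hx => rw [map_smul, hx, smul_zero]

variable {X : Module.Basis Comp k (NSym k)}

/-- The family dual to a homogeneous basis. -/
noncomputable def dualFamily (X : Module.Basis Comp k (NSym k)) (I : Comp) : QSym k :=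
  ∑ J : Composition I.1, X.coord I (prodFamily (S k) ⟨I.1, J⟩) • monomialQSym ⟨I.1, J⟩

/-- By homogeneity a coordinate functional lives in one degree, where the quasi-monomials are dual
to the finitely many S^J; so it comes from an element of QSym. -/
lemma pairing_dualFamily (hX : ∀ I, X I ∈ homogeneous k I.1) (I : Comp) :
    pairing (dualFamily X I) = X.coord I := by
  refine (completeBasis k).ext fun J => ?_
  rw [completeBasis_apply]
  change pairingHom (dualFamily X I) _ = _
  simp only [dualFamily, map_sum, map_smul, LinearMap.sum_apply, LinearMap.smul_apply]
  change ∑ K, _ • pairing (monomialQSym _) _ = _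
  simp only [pairing_monomialQSym]
  obtain ⟨n, J⟩ := J
  by_cases h : I.1 = n
  · subst h
    rw [Finset.sum_eq_single J]
    · simp
    · intro K _ hK
      rw [if_neg (by simpa using hK.symm), smul_zero]
    · simp
  · rw [coord_prodFamily_S_of_ne hX h, Finset.sum_eq_zero]
    intro K _
    rw [if_neg fun hK => h (congrArg Sigma.fst hK).symm, smul_zero]

lemma isDual_dualFamily (hX : ∀ I, X I ∈ homogeneous k I.1) : IsDual (dualFamily X) X := by
  intro I J
  rw [pairing_dualFamily hX, X.coord_apply, X.repr_self, Finsupp.single_apply]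
  exact if_congr eq_comm rfl rfl

lemma linearIndependent_of_isDual {Z : Comp → QSym k} (hZ : IsDual Z X) :
    LinearIndependent k Z := by
  rw [linearIndependent_iff']
  intro s g hg I hI
  have h := LinearMap.congr_fun (congrArg pairingHom hg) (X I)
  simp only [map_sum, map_smul, LinearMap.sum_apply, LinearMap.smul_apply, map_zero,
    LinearMap.zero_apply] at h
  change ∑ J ∈ s, g J • pairing (Z J) (X I) = 0 at h
  simpa [hZ _ _, hI] using h

/-- A quasi-monomial of degree n pairs to 0 with the members of `X` of other degrees, so its
expansion in `Z` is finite; the expansion is verified by pairing with `X`. -/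
lemma span_of_isDual (hX : ∀ I, X I ∈ homogeneous k I.1) {Z : Comp → QSym k} (hZ : IsDual Z X) :
    ⊤ ≤ Submodule.span k (Set.range Z) := by
  have hM (J : Comp) : (monomialQSym J : QSym k) ∈ Submodule.span k (Set.range Z) := by
    have h : (monomialQSym J : QSym k) =
        ∑ I : Composition J.1, pairing (monomialQSym J) (X ⟨J.1, I⟩) • Z ⟨J.1, I⟩ := by
      refine pairing_injective (X.ext fun K => ?_)
      change _ = pairingHom (∑ I : Composition J.1, _ • Z ⟨J.1, I⟩) _
      simp only [map_sum, map_smul, LinearMap.sum_apply, LinearMap.smul_apply]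
      change _ = ∑ I : Composition J.1, _ • pairing (Z ⟨J.1, I⟩) _
      simp only [hZ _ _]
      obtain ⟨n, K⟩ := K
      by_cases h : J.1 = n
      · subst h
        rw [Finset.sum_eq_single K]
        · simp
        · intro I _ hI
          rw [if_neg (by simpa using hI), smul_zero]
        · simp
      · rw [pairing_monomialQSym_of_mem (hX ⟨n, K⟩) h, Finset.sum_eq_zero]
        intro I _
        rw [if_neg fun hI => h (congrArg Sigma.fst hI), smul_zero]
    rw [h]
    exact Submodule.sum_mem _ fun I _ => Submodule.smul_mem _ _ (Submodule.subset_span ⟨_, rfl⟩)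
  rintro ⟨f, hf⟩ -
  induction hf using Submodule.span_induction with
  | mem x hx => obtain ⟨I, rfl⟩ := hx; exact hM I
  | zero => exact Submodule.zero_mem _
  | add x y hx hy ihx ihy => exact Submodule.add_mem _ ihx ihy
  | smul a x hx ih => exact Submodule.smul_mem _ a ih

lemma existsUnique_dual_basis (hX : ∀ I, X I ∈ homogeneous k I.1) :
    ∃! Z : Module.Basis Comp k (QSym k), IsDual Z X := by
  have hZ := isDual_dualFamily hX
  refine ⟨Module.Basis.mk (linearIndependent_of_isDual hZ) (span_of_isDual hX hZ), ?_, ?_⟩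
  · simpa using hZ
  · intro Y hY
    refine Module.Basis.eq_of_apply_eq fun I => pairing_injective (X.ext fun J => ?_)
    rw [hY, Module.Basis.mk_apply, hZ]

end Dual

end NCSF

namespace NCSF

/-! ### Products of primitive elements -/

section Primitive

variable {k : Type*} [Field k]

lemma sum_count_shuffle_smul {M : Type*} [AddCommMonoid M] {n : ℕ} (I : Composition n)
    (F : List ℕ → List ℕ → M) :
    ∑ p ∈ Finset.HasAntidiagonal.antidiagonal n, ∑ K : Composition p.1, ∑ L : Composition p.2,
        ((shuffle K.blocks L.blocks).count I.blocks) • F K.blocks L.blocks =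
      ((splits I.blocks).map fun u => F u.1 u.2).sum := by
  let e : (Σ p : {p : ℕ × ℕ // p ∈ Finset.HasAntidiagonal.antidiagonal n},
      Composition p.1.1 × Composition p.1.2) → List ℕ × List ℕ :=
    fun x => (x.2.1.blocks, x.2.2.blocks)
  have he : Function.Injective e := by
    rintro ⟨⟨⟨a, b⟩, h⟩, K, L⟩ ⟨⟨⟨a', b'⟩, h'⟩, K', L'⟩ hKL
    have h1 : (⟨a, K⟩ : Comp) = ⟨a', K'⟩ := comp_ext (congrArg Prod.fst hKL)
    have h2 : (⟨b, L⟩ : Comp) = ⟨b', L'⟩ := comp_ext (congrArg Prod.snd hKL)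
    cases h1
    cases h2
    rfl
  rw [← sum_count_smul he, Fintype.sum_sigma, ← Finset.sum_coe_sort]
  · refine Finset.sum_congr rfl fun p _ => ?_
    rw [Fintype.sum_prod_type]
    simp only [e, count_splits]
  · rintro ⟨u, v⟩ huv
    have hperm := perm_of_mem_splits huv
    have hpos : ∀ i ∈ u ++ v, 0 < i := fun i hi => I.blocks_pos (hperm.mem_iff.1 hi)
    obtain ⟨K, hK⟩ := exists_composition (l := u) (fun i hi => hpos i (by simp [hi])) rfl
    obtain ⟨L, hL⟩ := exists_composition (l := v) (fun i hi => hpos i (by simp [hi])) rfl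
    refine ⟨⟨⟨(u.sum, v.sum), ?_⟩, K, L⟩, Prod.ext hK hL⟩
    rw [Finset.HasAntidiagonal.mem_antidiagonal, ← List.sum_append, hperm.sum_eq, I.blocks_sum]

/-- Each factor P_i ⊗ 1 + 1 ⊗ P_i sends the letter `i` to the left or to the right subword. -/
lemma comul_prod_of_isPrimitive {P : ℕ → NSym k} {l : List ℕ} (hP : ∀ i ∈ l, IsPrimitive (P i)) :
    comul k (l.map P).prod =
      ((splits l).map fun u => (u.1.map P).prod ⊗ₜ[k] (u.2.map P).prod).sum := by
  induction l with
  | nil => simp [splits, Algebra.TensorProduct.one_def]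
  | cons i l ih =>
    rw [List.map_cons, List.prod_cons, map_mul, hP i (by simp), ih fun j hj => hP j (by simp [hj]),
      add_mul, splits, Multiset.map_add, Multiset.sum_add, Multiset.map_map, Multiset.map_map,
      ← Multiset.sum_map_mul_left, ← Multiset.sum_map_mul_left]
    simp

lemma hasUnshuffleCoproduct_prodFamily {P : ℕ → NSym k} (hP : ∀ n, 1 ≤ n → IsPrimitive (P n)) :
    HasUnshuffleCoproduct (prodFamily P) := by
  intro n I
  rw [prodFamily, comul_prod_of_isPrimitive fun i hi => hP i (I.blocks_pos hi),
    ← sum_count_shuffle_smul I fun u v => (u.map P).prod ⊗ₜ[k] (v.map P).prod]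
  rfl

end Primitive

/-! ### Homogeneous sequences -/

section Homogeneous

variable {k : Type*} [Field k]

lemma one_mem_homogeneous : (1 : NSym k) ∈ homogeneous k 0 :=
  Submodule.subset_span ⟨Composition.ones 0, by simp [prodFamily]⟩

lemma S_mem_homogeneous (n : ℕ) : S k n ∈ homogeneous k n := by
  cases n with
  | zero => exact one_mem_homogeneous
  | succ n =>
    exact Submodule.subset_span ⟨Composition.single (n + 1) n.succ_pos, by simp [prodFamily]⟩

lemma mul_mem_homogeneous {m n : ℕ} {x y : NSym k} (hx : x ∈ homogeneous k m)
    (hy : y ∈ homogeneous k n) : x * y ∈ homogeneous k (m + n) := by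
  refine (Submodule.span_mul_span k _ _).le.trans (Submodule.span_mono ?_)
    (Submodule.mul_mem_mul hx hy)
  rintro _ ⟨_, ⟨I, rfl⟩, _, ⟨J, rfl⟩, rfl⟩
  exact ⟨I.append J, by simp [prodFamily, Composition.append]⟩

lemma prodFamily_mem_homogeneous {P : ℕ → NSym k} (hP : ∀ n, P n ∈ homogeneous k n) (I : Comp) :
    prodFamily P I ∈ homogeneous k I.1 := by
  have h (l : List ℕ) : (l.map P).prod ∈ homogeneous k l.sum := by
    induction l with
    | nil => exact one_mem_homogeneous
    | cons i l ih => simpa using mul_mem_homogeneous (hP i) ih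
  simpa [prodFamily] using h I.2.blocks

lemma Psi_mem_homogeneous (n : ℕ) : Psi k n ∈ homogeneous k n := by
  induction n using Nat.strong_induction_on with
  | _ n ih =>
    rw [Psi]
    refine Submodule.sub_mem _ (Submodule.smul_mem _ _ (S_mem_homogeneous n))
      (Submodule.sum_mem _ fun i _ => ?_)
    have := mul_mem_homogeneous (S_mem_homogeneous (k := k) (n - i)) (ih i i.2)
    rwa [Nat.sub_add_cancel i.2.le] at this

lemma coeff_mk_S_sub_one (n : ℕ) :
    PowerSeries.coeff n (PowerSeries.mk (S k) - 1) = if n = 0 then 0 else S k n := by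
  rw [map_sub, PowerSeries.coeff_mk, PowerSeries.coeff_one]
  split_ifs with h
  · simp [h, S]
  · simp

lemma coeff_pow_mem_homogeneous (m n : ℕ) :
    PowerSeries.coeff n ((PowerSeries.mk (S k) - 1) ^ m) ∈ homogeneous k n := by
  induction m generalizing n with
  | zero =>
    rw [pow_zero, PowerSeries.coeff_one]
    split_ifs with h
    · exact h ▸ one_mem_homogeneous
    · exact Submodule.zero_mem _
  | succ m ih =>
    rw [pow_succ, PowerSeries.coeff_mul]
    refine Submodule.sum_mem _ fun p hp => ?_
    rw [← Finset.HasAntidiagonal.mem_antidiagonal.1 hp, coeff_mk_S_sub_one]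
    split_ifs
    · rw [mul_zero]; exact Submodule.zero_mem _
    · exact mul_mem_homogeneous (ih p.1) (S_mem_homogeneous p.2)

lemma Phi_mem_homogeneous (n : ℕ) : Phi k n ∈ homogeneous k n :=
  Submodule.smul_mem _ _ (Submodule.sum_mem _ fun m _ =>
    Submodule.smul_mem _ _ (coeff_pow_mem_homogeneous m n))

end Homogeneous

/-! ### Triangular sequences of generators -/

section Triangular

variable (k : Type*) [Field k]

/-- The subalgebra generated by `S_j`, `j < n`. -/
def lowerAlgebra (n : ℕ) : Subalgebra k (NSym k) := Algebra.adjoin k (S k '' Set.Iio n)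

lemma lowerAlgebra_mono {m n : ℕ} (h : m ≤ n) : lowerAlgebra k m ≤ lowerAlgebra k n :=
  Algebra.adjoin_mono (Set.image_mono (Set.Iio_subset_Iio h))

lemma S_mem_lowerAlgebra {m n : ℕ} (h : m < n) : S k m ∈ lowerAlgebra k n :=
  Algebra.subset_adjoin ⟨m, h, rfl⟩

variable {k}

/-- Endomorphisms sending each `S_n` to a nonzero multiple of `S_n`, up to the `S_j` with
`j < n`. -/
def IsTriangular (φ : NSym k →ₐ[k] NSym k) : Prop :=
  ∀ n, ∃ a : k, a ≠ 0 ∧ φ (S k n) - a • S k n ∈ lowerAlgebra k n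

lemma lift_S (x : ℕ → NSym k) {n : ℕ} (hn : n ≠ 0) :
    FreeAlgebra.lift k (fun i : ℕ+ => x i) (S k n) = x n := by
  cases n with
  | zero => contradiction
  | succ n => rw [S, FreeAlgebra.lift_ι_apply]; simp

lemma algHom_ext_S {φ ψ : NSym k →ₐ[k] NSym k} (h : ∀ n, n ≠ 0 → φ (S k n) = ψ (S k n)) :
    φ = ψ := by
  refine FreeAlgebra.hom_ext (funext fun i => ?_)
  simpa [S_coe_pnat] using h i i.ne_zero

/-- Preimages of the generators are found recursively by dividing by the leading coefficient. The
section is again triangular, so the construction can be applied to it in turn. -/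
lemma IsTriangular.exists_section {φ : NSym k →ₐ[k] NSym k} (hφ : IsTriangular φ) :
    ∃ ψ : NSym k →ₐ[k] NSym k, IsTriangular ψ ∧ φ.comp ψ = AlgHom.id k _ := by
  have h (n : ℕ) : ∃ (x : NSym k) (a : k), a ≠ 0 ∧ φ x = S k n ∧
      x - a • S k n ∈ lowerAlgebra k n := by
    induction n using Nat.strong_induction_on with
    | _ n ih =>
      obtain ⟨a, ha, hmem⟩ := hφ n
      -- By induction the lower generators have preimages among the lower generators, so the error
      -- term can be corrected.
      have hle : lowerAlgebra k n ≤ (lowerAlgebra k n).map φ := by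
        refine Algebra.adjoin_le ?_
        rintro _ ⟨j, hj, rfl⟩
        obtain ⟨x, b, -, hx, hxb⟩ := ih j hj
        refine ⟨x, ?_, hx⟩
        have := (lowerAlgebra k n).add_mem (lowerAlgebra_mono k (le_of_lt hj) hxb)
          ((lowerAlgebra k n).smul_mem (S_mem_lowerAlgebra k hj) b)
        rwa [sub_add_cancel] at this
      obtain ⟨y, hy, hyeq⟩ := hle hmem
      refine ⟨a⁻¹ • (S k n - y), a⁻¹, inv_ne_zero ha, ?_, ?_⟩
      · have hyeq' : φ y = φ (S k n) - a • S k n := hyeq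
        rw [map_smul, map_sub, hyeq', sub_sub_cancel, inv_smul_smul₀ ha]
      · rw [smul_sub, sub_sub_cancel_left]
        exact (lowerAlgebra k n).neg_mem ((lowerAlgebra k n).smul_mem hy _)
  choose x a ha hx hmem using h
  refine ⟨FreeAlgebra.lift k fun i : ℕ+ => x i, fun n => ?_, algHom_ext_S fun n hn => ?_⟩
  · rcases eq_or_ne n 0 with rfl | hn
    · exact ⟨1, one_ne_zero, by simp [S]⟩
    · exact ⟨a n, ha n, by rw [lift_S x hn]; exact hmem n⟩
  · rw [AlgHom.comp_apply, lift_S x hn, hx, AlgHom.id_apply]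

/-- The section `ψ` is right inverse to `φ` and has itself a right inverse `χ`; then `φ = χ`, so the
inverse is two-sided. -/
lemma IsTriangular.bijective {φ : NSym k →ₐ[k] NSym k} (hφ : IsTriangular φ) :
    Function.Bijective φ := by
  obtain ⟨ψ, hψ, h⟩ := hφ.exists_section
  obtain ⟨χ, -, h'⟩ := hψ.exists_section
  have hχ : φ = χ := by
    rw [← AlgHom.comp_id φ, ← h', ← AlgHom.comp_assoc, h, AlgHom.id_comp]
  rw [← hχ] at h'
  exact ⟨Function.LeftInverse.injective (AlgHom.congr_fun h'),
    Function.RightInverse.surjective (AlgHom.congr_fun h)⟩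

lemma exists_basis_prodFamily {P : ℕ → NSym k}
    (hP : ∀ n, n ≠ 0 → ∃ a : k, a ≠ 0 ∧ P n - a • S k n ∈ lowerAlgebra k n) :
    ∃ V : Module.Basis Comp k (NSym k), ∀ I, V I = prodFamily P I := by
  set φ : NSym k →ₐ[k] NSym k := FreeAlgebra.lift k fun i : ℕ+ => P i with hφ
  have htri : IsTriangular φ := fun n => by
    rcases eq_or_ne n 0 with rfl | hn
    · exact ⟨1, one_ne_zero, by simp [S]⟩
    · rw [hφ, lift_S P hn]; exact hP n hn
  refine ⟨(completeBasis k).map (LinearEquiv.ofBijective φ.toLinearMap htri.bijective),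
    fun I => ?_⟩
  rw [Module.Basis.map_apply, completeBasis_apply]
  change φ (prodFamily (S k) I) = _
  rw [prodFamily, map_list_prod, List.map_map, prodFamily]
  congr 1
  exact List.map_congr_left fun i hi => lift_S P (I.2.blocks_pos hi).ne'

/-! ### The power sums as triangular generators. -/

lemma Psi_zero : Psi k 0 = 0 := by rw [Psi]; simp

lemma Psi_sub_mem_lowerAlgebra (n : ℕ) : Psi k n - (n : k) • S k n ∈ lowerAlgebra k n := by
  induction n using Nat.strong_induction_on with
  | _ n ih =>
    rw [Psi, sub_sub_cancel_left]
    refine (lowerAlgebra k n).neg_mem ((lowerAlgebra k n).sum_mem fun i _ => ?_)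
    -- The term `i = 0` contains S_n itself, which is not a lower generator, but its other factor
    -- vanishes.
    rcases Nat.eq_zero_or_pos (i : ℕ) with h | h
    · rw [h, Psi_zero, mul_zero]; exact (lowerAlgebra k n).zero_mem
    · refine (lowerAlgebra k n).mul_mem (S_mem_lowerAlgebra k (by omega)) ?_
      have := (lowerAlgebra k n).add_mem (lowerAlgebra_mono k i.2.le (ih i i.2))
        ((lowerAlgebra k n).smul_mem (S_mem_lowerAlgebra k i.2) ((i : ℕ) : k))
      rwa [sub_add_cancel] at this

lemma coeff_pow_mem_lowerAlgebra {m n q : ℕ} (hq : q < n) :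
    PowerSeries.coeff q ((PowerSeries.mk (S k) - 1) ^ m) ∈ lowerAlgebra k n := by
  induction m generalizing q with
  | zero =>
    rw [pow_zero, PowerSeries.coeff_one]
    split_ifs
    exacts [(lowerAlgebra k n).one_mem, (lowerAlgebra k n).zero_mem]
  | succ m ih =>
    rw [pow_succ, PowerSeries.coeff_mul]
    refine (lowerAlgebra k n).sum_mem fun p hp => ?_
    have := Finset.HasAntidiagonal.mem_antidiagonal.1 hp
    rw [coeff_mk_S_sub_one]
    split_ifs
    · rw [mul_zero]; exact (lowerAlgebra k n).zero_mem
    · exact (lowerAlgebra k n).mul_mem (ih (by omega)) (S_mem_lowerAlgebra k (by omega))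

/-- Without constant term, a product of at least two factors reaches degree `n` only through
generators of smaller degree. So in the logarithm only `m = 1` produces S_n. -/
lemma coeff_pow_add_two_mem_lowerAlgebra (m n : ℕ) :
    PowerSeries.coeff n ((PowerSeries.mk (S k) - 1) ^ (m + 2)) ∈ lowerAlgebra k n := by
  rw [pow_succ, PowerSeries.coeff_mul]
  refine (lowerAlgebra k n).sum_mem fun p hp => ?_
  have := Finset.HasAntidiagonal.mem_antidiagonal.1 hp
  rw [coeff_mk_S_sub_one]
  split_ifs
  · rw [mul_zero]; exact (lowerAlgebra k n).zero_mem
  · rcases Nat.eq_zero_or_pos p.1 with h | h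
    · rw [h, PowerSeries.coeff_zero_eq_constantCoeff, map_pow, map_sub]
      simp [← PowerSeries.coeff_zero_eq_constantCoeff_apply, S]
    · exact (lowerAlgebra k n).mul_mem (coeff_pow_mem_lowerAlgebra (by omega))
        (S_mem_lowerAlgebra k (by omega))

lemma Phi_sub_mem_lowerAlgebra {n : ℕ} (hn : n ≠ 0) :
    Phi k n - (n : k) • S k n ∈ lowerAlgebra k n := by
  rw [Phi, ← Finset.insert_Icc_add_one_left_eq_Icc (Nat.one_le_iff_ne_zero.2 hn),
    Finset.sum_insert (by simp), smul_add]
  have h1 : PowerSeries.coeff n ((PowerSeries.mk (S k) - 1) ^ 1) = S k n := by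
    rw [pow_one, coeff_mk_S_sub_one, if_neg hn]
  rw [h1]
  simp only [Nat.sub_self, pow_zero, Nat.cast_one, div_one, one_smul, add_sub_cancel_left]
  refine (lowerAlgebra k n).smul_mem ((lowerAlgebra k n).sum_mem fun m hm =>
    (lowerAlgebra k n).smul_mem ?_ _) _
  obtain ⟨m, rfl⟩ : ∃ m', m = m' + 2 := ⟨m - 2, by have := (Finset.mem_Icc.1 hm).1; omega⟩
  exact coeff_pow_add_two_mem_lowerAlgebra m n

end Triangular

end NCSF

namespace NCSF

/-! ### Logarithms and logarithmic derivatives of power series over a noncommutative ring -/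

section Log

open Polynomial in
-- An identity polynomial in N that holds for all natural N is an identity of polynomials, by
-- looking at coordinates; it may then be differentiated at N = 0.
lemma sum_derivative_eval_zero_smul {k M ι κ : Type*} [Field k] [CharZero k] [AddCommGroup M]
    [Module k M] {s : Finset ι} {t : Finset κ} {p : ι → k[X]} {q : κ → k[X]} {v : ι → M}
    {w : κ → M} (h : ∀ N : ℕ, ∑ i ∈ s, (p i).eval (N : k) • v i =
      ∑ j ∈ t, (q j).eval (N : k) • w j) :
    ∑ i ∈ s, (derivative (p i)).eval 0 • v i = ∑ j ∈ t, (derivative (q j)).eval 0 • w j := by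
  let b := Module.Basis.ofVectorSpace k M
  refine b.repr.injective (Finsupp.ext fun x => ?_)
  have key : ∑ i ∈ s, p i * C (b.repr (v i) x) = ∑ j ∈ t, q j * C (b.repr (w j) x) := by
    refine eq_of_infinite_eval_eq _ _ ((Set.infinite_range_of_injective
      (Nat.cast_injective (R := k))).mono ?_)
    rintro _ ⟨N, rfl⟩
    have := congrArg (fun y => b.repr y x) (h N)
    simpa [eval_finsetSum, Finsupp.finsetSum_apply] using this
  have := congrArg (fun r => (derivative r).eval 0) key
  simpa [eval_finsetSum, Finsupp.finsetSum_apply] using this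

variable (k : Type*) [Field k]

/-- The binomial coefficient `X` over `m` as a polynomial. -/
noncomputable def binomPoly (m : ℕ) : Polynomial k :=
  Polynomial.C ((m.factorial : k)⁻¹) * descPochhammer k m

lemma eval_natCast_binomPoly [CharZero k] (m N : ℕ) :
    (binomPoly k m).eval (N : k) = (N.choose m : k) := by
  rw [binomPoly, Polynomial.eval_mul, Polynomial.eval_C, descPochhammer_eval_eq_descFactorial,
    Nat.descFactorial_eq_factorial_mul_choose, Nat.cast_mul,
    inv_mul_cancel_left₀ (Nat.cast_ne_zero.2 m.factorial_ne_zero)]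

lemma eval_zero_binomPoly [CharZero k] (m : ℕ) :
    (binomPoly k m).eval 0 = if m = 0 then 1 else 0 := by
  have := eval_natCast_binomPoly k m 0
  rw [Nat.cast_zero] at this
  rw [this]
  cases m <;> simp

lemma eval_zero_derivative_binomPoly_zero :
    (Polynomial.derivative (binomPoly k 0)).eval 0 = 0 := by
  simp [binomPoly]

lemma eval_zero_derivative_binomPoly [CharZero k] (m : ℕ) :
    (Polynomial.derivative (binomPoly k (m + 1))).eval 0 = (-1) ^ m / ((m + 1 : ℕ) : k) := by
  have h : (Polynomial.derivative (descPochhammer k (m + 1))).eval 0 =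
      (-1) ^ m * (m.factorial : k) := by
    induction m with
    | zero => simp
    | succ m ih =>
      have h0 : (descPochhammer k (m + 1)).eval 0 = 0 := by
        rw [descPochhammer_succ_left]; simp
      rw [descPochhammer_succ_right, Polynomial.derivative_mul, Polynomial.eval_add,
        Polynomial.eval_mul, Polynomial.eval_mul, ih, h0]
      simp [Nat.factorial_succ]
      ring
  rw [binomPoly, Polynomial.derivative_C_mul, Polynomial.eval_mul, Polynomial.eval_C, h,
    Nat.factorial_succ]
  have h1 : ((m + 1 : ℕ) : k) ≠ 0 := Nat.cast_ne_zero.2 m.succ_ne_zero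
  have h2 : (m.factorial : k) ≠ 0 := Nat.cast_ne_zero.2 m.factorial_ne_zero
  rw [Nat.cast_mul]
  field_simp

variable {R : Type*} [Ring R] [Algebra k R]

/-- The coefficients of the logarithm of a power series with constant coefficient `1`. -/
noncomputable def logCoeff (n : ℕ) (f : PowerSeries R) : R :=
  ∑ m ∈ Finset.Icc 1 n, ((-1 : k) ^ (m - 1) / (m : k)) • PowerSeries.coeff n ((f - 1) ^ m)

/-- The logarithm of f is the derivative at N = 0 of f^N = ∑ binom(N, m) (f - 1)^m. -/
lemma logCoeff_eq [CharZero k] (n : ℕ) (f : PowerSeries R) :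
    logCoeff k n f = ∑ m ∈ Finset.range (n + 1),
      (Polynomial.derivative (binomPoly k m)).eval 0 • PowerSeries.coeff n ((f - 1) ^ m) := by
  rw [logCoeff, Finset.sum_range_succ', eval_zero_derivative_binomPoly_zero, zero_smul, add_zero,
    Finset.range_eq_Ico, Finset.sum_Ico_add' (fun m => (Polynomial.derivative
      (binomPoly k m)).eval 0 • PowerSeries.coeff n ((f - 1) ^ m)) 0 n 1]
  refine Finset.sum_congr rfl fun m hm => ?_
  obtain ⟨m, rfl⟩ : ∃ m', m = m' + 1 := ⟨m - 1, by have := (Finset.mem_Ico.1 hm).1; omega⟩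
  rw [eval_zero_derivative_binomPoly, Nat.add_sub_cancel]

lemma coeff_pow_eq_zero {u : PowerSeries R} (hu : PowerSeries.constantCoeff u = 0) {n a : ℕ}
    (h : n < a) : PowerSeries.coeff n (u ^ a) = 0 := by
  induction a generalizing n with
  | zero => omega
  | succ a ih =>
    rw [pow_succ, PowerSeries.coeff_mul]
    refine Finset.sum_eq_zero fun p hp => ?_
    have := Finset.HasAntidiagonal.mem_antidiagonal.1 hp
    rcases Nat.eq_zero_or_pos p.2 with h2 | h2
    · rw [h2, PowerSeries.coeff_zero_eq_constantCoeff_apply, hu, mul_zero]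
    · rw [ih (by omega), zero_mul]

/-- The binomial theorem, cut off at a bound independent of N, so that each coefficient of f^N is
visibly a polynomial in N. -/
lemma coeff_pow_eq_sum [CharZero k] {f : PowerSeries R} (hf : PowerSeries.constantCoeff f = 1)
    {p n : ℕ} (hp : p ≤ n) (N : ℕ) :
    PowerSeries.coeff p (f ^ N) = ∑ a ∈ Finset.range (n + 1),
      (binomPoly k a).eval (N : k) • PowerSeries.coeff p ((f - 1) ^ a) := by
  have hu : PowerSeries.constantCoeff (f - 1) = 0 := by rw [map_sub, hf, map_one, sub_self]
  have h1 : f ^ N = ∑ a ∈ Finset.range (N + 1), (f - 1) ^ a * (N.choose a : PowerSeries R) := by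
    conv_lhs => rw [← sub_add_cancel f 1, (Commute.one_right (f - 1)).add_pow]
    simp
  have h2 (a : ℕ) : PowerSeries.coeff p ((f - 1) ^ a * (N.choose a : PowerSeries R)) =
      (binomPoly k a).eval (N : k) • PowerSeries.coeff p ((f - 1) ^ a) := by
    rw [eval_natCast_binomPoly, ← nsmul_eq_mul', map_nsmul, Nat.cast_smul_eq_nsmul]
  rw [h1, map_sum]
  simp only [h2]
  -- Both ranges are extended to a common one: the extra terms vanish by the binomial coefficient on
  -- one side, by the order of (f - 1)^a on the other.
  rw [Finset.sum_subset (Finset.range_mono (show N + 1 ≤ N + 1 + (n + 1) by omega)),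
    ← Finset.sum_subset (Finset.range_mono (show n + 1 ≤ N + 1 + (n + 1) by omega))]
  · intro a _ ha
    rw [coeff_pow_eq_zero hu (by simp at ha; omega), smul_zero]
  · intro a _ ha
    rw [eval_natCast_binomPoly, Nat.choose_eq_zero_of_lt (by simpa using ha), Nat.cast_zero,
      zero_smul]

/-- The logarithm of a product of commuting power series. -/
lemma logCoeff_mul [CharZero k] {f g : PowerSeries R} (hfg : Commute f g)
    (hf : PowerSeries.constantCoeff f = 1) (hg : PowerSeries.constantCoeff g = 1) (n : ℕ) :
    logCoeff k n (f * g) = logCoeff k n f + logCoeff k n g := by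
  -- This is (fg)^N = f^N g^N, where commutativity enters.
  have key : ∀ N : ℕ, ∑ m ∈ Finset.range (n + 1),
      (binomPoly k m).eval (N : k) • PowerSeries.coeff n ((f * g - 1) ^ m) =
      ∑ x ∈ Finset.HasAntidiagonal.antidiagonal n ×ˢ
        (Finset.range (n + 1) ×ˢ Finset.range (n + 1)),
        (binomPoly k x.2.1 * binomPoly k x.2.2).eval (N : k) •
          (PowerSeries.coeff x.1.1 ((f - 1) ^ x.2.1) *
            PowerSeries.coeff x.1.2 ((g - 1) ^ x.2.2)) := by
    intro N
    rw [← coeff_pow_eq_sum k (by rw [map_mul, hf, hg, one_mul]) le_rfl, hfg.mul_pow,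
      PowerSeries.coeff_mul, Finset.sum_product]
    refine Finset.sum_congr rfl fun p hp => ?_
    have := Finset.HasAntidiagonal.mem_antidiagonal.1 hp
    rw [coeff_pow_eq_sum k hf (show p.1 ≤ n by omega), coeff_pow_eq_sum k hg (show p.2 ≤ n by omega),
      Finset.sum_mul_sum, Finset.sum_product]
    simp only [Polynomial.eval_mul, smul_mul_smul_comm]
  have h := sum_derivative_eval_zero_smul key
  rw [← logCoeff_eq, Finset.sum_product] at h
  rw [h]
  -- In each Leibniz term one binomial polynomial is evaluated at 0, which forces its exponent to be
  -- 0 and its power series to be 1; what remains is one of the two logarithms.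
  simp only [Polynomial.derivative_mul, Polynomial.eval_add, Polynomial.eval_mul,
    eval_zero_binomPoly, add_smul, Finset.sum_add_distrib, Finset.sum_product]
  congr 1
  · rw [Finset.sum_eq_single (n, 0)]
    · simp [logCoeff_eq]
    · rintro ⟨p, q⟩ hpq hne
      have := Finset.HasAntidiagonal.mem_antidiagonal.1 hpq
      have hq : q ≠ 0 := by
        rintro rfl
        exact hne (Prod.ext (by simpa using this) rfl)
      simp [PowerSeries.coeff_one, hq]
    · intro h
      exact absurd (Finset.HasAntidiagonal.mem_antidiagonal.2 (add_zero n)) h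
  · rw [Finset.sum_eq_single (0, n)]
    · simp [logCoeff_eq]
    · rintro ⟨p, q⟩ hpq hne
      have := Finset.HasAntidiagonal.mem_antidiagonal.1 hpq
      have hp : p ≠ 0 := by
        rintro rfl
        exact hne (Prod.ext rfl (by simpa using this))
      simp [PowerSeries.coeff_one, hp]
    · intro h
      exact absurd (Finset.HasAntidiagonal.mem_antidiagonal.2 (zero_add n)) h

lemma map_logCoeff {R' : Type*} [Ring R'] [Algebra k R'] (φ : R →ₐ[k] R') (n : ℕ)
    (f : PowerSeries R) :
    φ (logCoeff k n f) = logCoeff k n (PowerSeries.map φ.toRingHom f) := by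
  simp only [logCoeff, map_sum, map_smul]
  refine Finset.sum_congr rfl fun m _ => ?_
  rw [← map_one (PowerSeries.map φ.toRingHom), ← map_sub, ← map_pow, PowerSeries.coeff_map]
  rfl

/-- The derivation `t d/dt`. -/
noncomputable def eulerDeriv (f : PowerSeries R) : PowerSeries R :=
  PowerSeries.mk fun n => n • PowerSeries.coeff n f

lemma eulerDeriv_mul (f g : PowerSeries R) :
    eulerDeriv (f * g) = eulerDeriv f * g + f * eulerDeriv g := by
  ext n
  simp only [eulerDeriv, PowerSeries.coeff_mk, PowerSeries.coeff_mul, map_add, Finset.smul_sum]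
  rw [← Finset.sum_add_distrib]
  refine Finset.sum_congr rfl fun p hp => ?_
  rw [← Finset.HasAntidiagonal.mem_antidiagonal.1 hp, add_smul, smul_mul_assoc, mul_smul_comm]

lemma map_eulerDeriv {R' : Type*} [Ring R'] (φ : R →+* R') (f : PowerSeries R) :
    PowerSeries.map φ (eulerDeriv f) = eulerDeriv (PowerSeries.map φ f) := by
  ext n
  simp [eulerDeriv]

lemma mul_left_cancel_of_constantCoeff {f g h : PowerSeries R}
    (hf : PowerSeries.constantCoeff f = 1) (hfgh : f * g = f * h) : g = h := by
  ext n
  induction n using Nat.strong_induction_on with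
  | _ n ih =>
    have hmem : (0, n) ∈ Finset.HasAntidiagonal.antidiagonal n :=
      Finset.HasAntidiagonal.mem_antidiagonal.2 (zero_add n)
    have := congrArg (PowerSeries.coeff n) hfgh
    rw [PowerSeries.coeff_mul, PowerSeries.coeff_mul,
      ← Finset.add_sum_erase _ _ hmem, ← Finset.add_sum_erase _ _ hmem,
      PowerSeries.coeff_zero_eq_constantCoeff_apply, hf, one_mul, one_mul] at this
    rw [Finset.sum_congr rfl fun p hp => ?_] at this
    · exact add_right_cancel this
    · rw [Finset.mem_erase, Finset.HasAntidiagonal.mem_antidiagonal] at hp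
      have h1 : p.1 ≠ 0 := fun h => hp.1 (Prod.ext h (by simp; omega))
      rw [ih p.2 (by omega)]

end Log

/-! ### The power sums are primitive -/

section PowerSums

variable (k : Type*) [Field k]

/-- The generating function of the complete functions. -/
noncomputable def sigma : PowerSeries (NSym k) := PowerSeries.mk (S k)

/-- A power series over `Sym`, in the left factor of `Sym ⊗ Sym`. -/
noncomputable def leftSeries (f : PowerSeries (NSym k)) : PowerSeries (NSym k ⊗[k] NSym k) :=
  PowerSeries.map
    (Algebra.TensorProduct.includeLeft : NSym k →ₐ[k] NSym k ⊗[k] NSym k).toRingHom f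

/-- A power series over `Sym`, in the right factor of `Sym ⊗ Sym`. -/
noncomputable def rightSeries (f : PowerSeries (NSym k)) : PowerSeries (NSym k ⊗[k] NSym k) :=
  PowerSeries.map
    (Algebra.TensorProduct.includeRight : NSym k →ₐ[k] NSym k ⊗[k] NSym k).toRingHom f

lemma coeff_leftSeries (f : PowerSeries (NSym k)) (n : ℕ) :
    PowerSeries.coeff n (leftSeries k f) = PowerSeries.coeff n f ⊗ₜ[k] 1 := rfl

lemma coeff_rightSeries (f : PowerSeries (NSym k)) (n : ℕ) :
    PowerSeries.coeff n (rightSeries k f) = 1 ⊗ₜ[k] PowerSeries.coeff n f := rfl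

lemma commute_leftSeries_rightSeries (f g : PowerSeries (NSym k)) :
    Commute (leftSeries k f) (rightSeries k g) := by
  ext n
  rw [PowerSeries.coeff_mul, PowerSeries.coeff_mul, ← Finset.Nat.sum_antidiagonal_swap]
  refine Finset.sum_congr rfl fun p _ => ?_
  simp [coeff_leftSeries, coeff_rightSeries]

lemma map_comul_sigma :
    PowerSeries.map (comul k).toRingHom (sigma k) =
      leftSeries k (sigma k) * rightSeries k (sigma k) := by
  ext n
  rw [PowerSeries.coeff_map, PowerSeries.coeff_mul]
  rw [sigma, PowerSeries.coeff_mk]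
  refine (comul_S k n).trans (Finset.sum_congr rfl fun p _ => ?_)
  simp [coeff_leftSeries, coeff_rightSeries]

lemma constantCoeff_sigma : PowerSeries.constantCoeff (sigma k) = 1 := by
  rw [← PowerSeries.coeff_zero_eq_constantCoeff_apply, sigma, PowerSeries.coeff_mk, S]

lemma constantCoeff_map_sigma {R : Type*} [Ring R] (φ : NSym k →+* R) :
    PowerSeries.constantCoeff (PowerSeries.map φ (sigma k)) = 1 := by
  rw [← PowerSeries.coeff_zero_eq_constantCoeff_apply, PowerSeries.coeff_map,
    PowerSeries.coeff_zero_eq_constantCoeff_apply, constantCoeff_sigma, map_one]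

lemma eulerDeriv_sigma : eulerDeriv (sigma k) = sigma k * PowerSeries.mk (Psi k) := by
  ext n
  rw [PowerSeries.coeff_mul, ← Finset.Nat.sum_antidiagonal_swap]
  simp only [Prod.fst_swap, Prod.snd_swap, eulerDeriv, sigma, PowerSeries.coeff_mk]
  rw [Finset.Nat.sum_antidiagonal_eq_sum_range_succ (fun i j => S k j * Psi k i),
    Finset.sum_range_succ, Nat.sub_self, Finset.sum_range (fun i => S k (n - i) * Psi k i)]
  rw [Psi.eq_def k n, S, one_mul, add_sub_cancel, Nat.cast_smul_eq_nsmul]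

/-- Logarithmic derivatives add up for a product of commuting series: apply t d/dt to the
factorisation of Δσ and cancel Δσ on the left. -/
lemma isPrimitive_Psi (n : ℕ) : IsPrimitive (Psi k n) := by
  set ψ : PowerSeries (NSym k) := PowerSeries.mk (Psi k) with hψ
  have h : PowerSeries.map (comul k).toRingHom ψ = leftSeries k ψ + rightSeries k ψ := by
    refine mul_left_cancel_of_constantCoeff (constantCoeff_map_sigma k (comul k).toRingHom) ?_
    have hleft : eulerDeriv (leftSeries k (sigma k)) = leftSeries k (sigma k) * leftSeries k ψ := by
      rw [leftSeries, ← map_eulerDeriv, eulerDeriv_sigma, map_mul]; rfl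
    have hright : eulerDeriv (rightSeries k (sigma k)) =
        rightSeries k (sigma k) * rightSeries k ψ := by
      rw [rightSeries, ← map_eulerDeriv, eulerDeriv_sigma, map_mul]; rfl
    -- After the Leibniz rule, ψ ⊗ 1 is moved past 1 ⊗ σ so that the product of both copies of σ
    -- stands on the left.
    rw [← map_mul, ← eulerDeriv_sigma, map_eulerDeriv, map_comul_sigma, eulerDeriv_mul, hleft,
      hright, mul_assoc, (commute_leftSeries_rightSeries k ψ (sigma k)).eq, mul_add, mul_assoc,
      mul_assoc]
  have := congrArg (PowerSeries.coeff n) h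
  rw [PowerSeries.coeff_map, map_add, coeff_leftSeries, coeff_rightSeries, hψ,
    PowerSeries.coeff_mk] at this
  exact this

/-- Algebra morphisms commute with the logarithm, and the logarithm of Δσ is the sum of those of its
commuting factors. -/
lemma isPrimitive_Phi [CharZero k] (n : ℕ) : IsPrimitive (Phi k n) := by
  have h : Phi k n = (n : k) • logCoeff k n (sigma k) := rfl
  rw [IsPrimitive, h, map_smul, map_logCoeff, map_comul_sigma,
    logCoeff_mul k (commute_leftSeries_rightSeries k _ _) (constantCoeff_map_sigma k _)
      (constantCoeff_map_sigma k _), smul_add, leftSeries, rightSeries, ← map_logCoeff,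
    ← map_logCoeff, ← map_smul, ← map_smul]
  rfl

end PowerSums

end NCSF

theorem mainTheorem9 (k : Type*) [Field k] [CharZero k] :
    -- The claim for an arbitrary basis of `Sym` with the unshuffle coproduct.
    (∀ V : Module.Basis NCSF.Comp k (NCSF.NSym k), NCSF.HasUnshuffleCoproduct V →
      (∃ X : Module.Basis NCSF.Comp k (NCSF.NSym k), ∀ J, X J = NCSF.binaryX V J) ∧
      (∀ Z : NCSF.Comp → NCSF.QSym k, NCSF.IsDual Z (NCSF.binaryX V) →
        NCSF.BinaryShuffleRule Z) ∧
      ((∀ I : NCSF.Comp, V I ∈ NCSF.homogeneous k I.1) →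
        ∃! Z : Module.Basis NCSF.Comp k (NCSF.QSym k), NCSF.IsDual Z (NCSF.binaryX V))) ∧
    -- Products of primitive elements have the unshuffle coproduct.
    (∀ P : ℕ → NCSF.NSym k, (∀ n, 1 ≤ n → NCSF.IsPrimitive (P n)) →
      NCSF.HasUnshuffleCoproduct (NCSF.prodFamily P)) ∧
    -- The families `Ψ^I` and `Φ^I` are homogeneous bases of products of primitive elements.
    (∀ P : ℕ → NCSF.NSym k, P = NCSF.Psi k ∨ P = NCSF.Phi k →
      (∀ n, 1 ≤ n → NCSF.IsPrimitive (P n)) ∧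
      ∃ V : Module.Basis NCSF.Comp k (NCSF.NSym k),
        (∀ I, V I = NCSF.prodFamily P I) ∧
        (∀ I : NCSF.Comp, V I ∈ NCSF.homogeneous k I.1) ∧
        NCSF.HasUnshuffleCoproduct V) := by
  refine ⟨fun V hV => ⟨⟨NCSF.binaryBasis V, NCSF.binaryBasis_apply V⟩,
    fun Z hZ => NCSF.binaryShuffleRule_of_isDual V hV hZ, fun hhom => ?_⟩,
    fun P hP => NCSF.hasUnshuffleCoproduct_prodFamily hP, fun P hP => ?_⟩
  · have hX : ⇑(NCSF.binaryBasis V) = NCSF.binaryX V := funext (NCSF.binaryBasis_apply V)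
    rw [← hX]
    refine NCSF.existsUnique_dual_basis fun J => ?_
    rw [NCSF.binaryBasis_apply]
    exact Submodule.sum_mem _ fun I _ => Submodule.smul_of_tower_mem _ _ (hhom ⟨J.1, I⟩)
  · have hprim : ∀ n, 1 ≤ n → NCSF.IsPrimitive (P n) := by
      rcases hP with rfl | rfl
      exacts [fun n _ => NCSF.isPrimitive_Psi k n, fun n _ => NCSF.isPrimitive_Phi k n]
    have hhom : ∀ n, P n ∈ NCSF.homogeneous k n := by
      rcases hP with rfl | rfl
      exacts [NCSF.Psi_mem_homogeneous, NCSF.Phi_mem_homogeneous]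
    obtain ⟨V, hV⟩ : ∃ V : Module.Basis NCSF.Comp k (NCSF.NSym k),
        ∀ I, V I = NCSF.prodFamily P I := by
      refine NCSF.exists_basis_prodFamily fun n hn => ⟨n, Nat.cast_ne_zero.2 hn, ?_⟩
      rcases hP with rfl | rfl
      exacts [NCSF.Psi_sub_mem_lowerAlgebra n, NCSF.Phi_sub_mem_lowerAlgebra hn]
    refine ⟨hprim, V, hV, fun I => hV I ▸ NCSF.prodFamily_mem_homogeneous hhom I, ?_⟩
    rw [show ⇑V = NCSF.prodFamily P from funext hV]
    exact NCSF.hasUnshuffleCoproduct_prodFamily hprim
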